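/- Theorem 4.2 (plane wave approximation). Let $\lambda>0$ and let $\Omega=\{x\in\mathbb{R}^2:|x|\le 1\}$. For $0\le\alpha\le1$ let $\nu_\alpha=(1-\alpha)\frac{dx}{|\Omega|}+\alpha\frac{d\sigma}{|\partial\Omega|}$, where $dx$ is Lebesgue measure on $\Omega$ and $d\sigma$ is arc length on $\partial\Omega$. For $m\in\mathbb{N}=\{0,1,2,\dots\}$ let $V_m^e$ be the complex span of the $2m+1$ plane waves $$e_j(x)=e^{i\mathbf{k}_j\cdot x},\qquad \mathbf{k}_j=\lambda\Big(\cos\frac{2j\pi}{2m+1},\ \sin\frac{2j\pi}{2m+1}\Big),\qquad j=-m,\dots,m,$$ and let $$K(m)=K(V_m^e,\nu_\alpha)=\max_{x\in\Omega}\sum_{j}|L_j(x)|^2,$$ where $(L_j)$ is a basis of $V_m^e$ that is orthonormal in $L^2(\Omega,\nu_\alpha)$. Such a basis exists, the maximum is attained, and $K(m)$ does not depend on the choice of the basis. Moreover: 1. If $\alpha=0$ (the uniform measure), then for every $c_1<1/4$ there is a constant $c_0$, depending only on $c_1$ and $\lambda$, such that for all sufficiently large $m$ $$K(m)\ge c_0+c_1m^2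 .$$ 2. If $0<\alpha<1$, or if $\alpha=1$ and $J_n(\lambda)\ne0$ for every integer $n\ge0$, where $J_n$ is the Bessel function of the first kind of order $n$, then for every $C_2>1$ there is a constant $C_1$, depending only on $C_2$, $\lambda$ and $\alpha$, such that for all $m$ $$K(m)\le C_1+C_2\,\frac{2m}{\alpha}.$$ -/

import Mathlib

noncomputable section

open MeasureTheory

/-- The Euclidean plane. -/
abbrev Plane : Type := EuclideanSpace ℝ (Fin 2)

/-- The closed unit disc of the plane. -/
def unitDisc : Set Plane := Metric.closedBall 0 1

/-- The plane wave with wave vector `k`, the function `x ↦ exp (i k · x)`. -/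
def planeWave (k : Plane) (x : Plane) : ℂ :=
  Complex.exp (Complex.I * ((inner ℝ k x : ℝ) : ℂ))

/-- The wave vector of length `lam` and angle `2 j π / (2 m + 1)`. -/
def waveVector (lam : ℝ) (m : ℕ) (j : ℤ) : Plane :=
  !₂[lam * Real.cos (2 * j * Real.pi / (2 * m + 1)),
    lam * Real.sin (2 * j * Real.pi / (2 * m + 1))]

/-- The complex span of the `2 m + 1` plane waves with equispaced wave vectors,
`j = -m, …, m`, on the circle of radius `lam`. -/
def planeWaveSpace (lam : ℝ) (m : ℕ) : Submodule ℂ (Plane → ℂ) :=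
  Submodule.span ℂ
    ((fun j : ℤ => planeWave (waveVector lam m j)) '' Set.Icc (-(m : ℤ)) (m : ℤ))

/-- Arc length on the unit circle: the image of Lebesgue measure on `(-π, π]` under
the arc-length parametrization `t ↦ (cos t, sin t)`. -/
def arcLength : Measure Plane :=
  Measure.map (fun t : ℝ => (!₂[Real.cos t, Real.sin t] : Plane))
    (volume.restrict (Set.Ioc (-Real.pi) Real.pi))

/-- The sampling measure `(1 - α) dx / |Ω| + α dσ / |∂Ω|` on the unit disc `Ω`
(used for `0 ≤ α ≤ 1`). -/
def samplingMeasure (α : ℝ) : Measure Plane :=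
  (ENNReal.ofReal (1 - α) * (volume unitDisc)⁻¹) • volume.restrict unitDisc
    + (ENNReal.ofReal α * (arcLength Set.univ)⁻¹) • arcLength

/-- The finite family `L` is a basis of `V` that is orthonormal in `L²(ν)`.
(Linear independence follows from orthonormality.) -/
def IsONBasis (V : Submodule ℂ (Plane → ℂ)) (ν : Measure Plane) {n : ℕ}
    (L : Fin n → Plane → ℂ) : Prop :=
  Submodule.span ℂ (Set.range L) = V ∧ (∀ i, MemLp (L i) 2 ν) ∧
    ∀ i j, ∫ x, L i x * (starRingEnd ℂ) (L j x) ∂ν = if i = j then 1 else 0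

/-- `K` is the number `K(V, ν) = max_{x ∈ Ω} ∑ⱼ |Lⱼ(x)|²`: the space `V` has a basis that is
orthonormal in `L²(ν)`, and for each such basis `(Lⱼ)` the maximum over the unit disc is
attained and equals `K`. At most one real number `K` has this property. -/
def IsKernelMax (V : Submodule ℂ (Plane → ℂ)) (ν : Measure Plane) (K : ℝ) : Prop :=
  (∃ (n : ℕ) (L : Fin n → Plane → ℂ), IsONBasis V ν L) ∧
    ∀ (n : ℕ) (L : Fin n → Plane → ℂ), IsONBasis V ν L →
      IsGreatest ((fun x : Plane => ∑ j, ‖L j x‖ ^ 2) '' unitDisc) K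

/-- The Bessel function of the first kind of integer order `n`, by Bessel's integral
`J_n(x) = (1/π) ∫₀^π cos (n t - x sin t) dt`. -/
def besselJ (n : ℕ) (x : ℝ) : ℝ :=
  (1 / Real.pi) * ∫ t in (0 : ℝ)..Real.pi, Real.cos (n * t - x * Real.sin t)

end

/-!
Write `N = 2 m + 1` and let `f_k`, `|k| ≤ m`, be the discrete Fourier transform of the `N` plane
waves (`fourierWave`). It spans the same space (`span_fourierWave`). Rotation by `2 π / N` permutes
the plane waves cyclically and multiplies `f_k` by a `k`-dependent character, while the sampling
measure is rotation invariant; so the `f_k` are orthogonal, and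
`K(m) = max_x ∑_k |f_k x|² / ‖f_k‖²` (`waveKernel`, `exists_isKernelMax`).

Everything else rests on one estimate. With `z = x₀ + i x₁`, a plane wave is
`exp (i lam z ω⁻ʲ / 2) * exp (i lam conj z ωʲ / 2)`, `ω = exp (2 π i / N)`, so that averaging over
`j` keeps exactly the monomials `z ^ a * conj z ^ b` with `a - b ≡ k` modulo `N`
(`hasSum_fourierWave`). Among these the monomial of degree `|k|` has modulus
`(lam |x| / 2) ^ |k| / |k|!`, and each of the others has `a > |k|` or `b > |k|`; hence `|f_k x|`
equals that modulus up to a relative error `O(|x| / (|k| + 1))`, uniformly in `m`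
(`abs_norm_fourierWave_sub_leadTerm_le`).

For the uniform measure, the mean of `|x| ^ (2 |k|)` over the disc is `1 / (|k| + 1)`, so at a
boundary point the frequency `k` contributes about `|k| + 1` to the kernel, and the sum over `k` is
about `m²` (`exists_le_waveKernel_zero`). If the measure gives mass `α > 0` to the circle, the
contribution of `k` is at most about `1 / α` for large `|k|`, and the finitely many remaining
frequencies contribute a bounded amount, because `|f_k| ≤ 1` and `‖f_k‖` is bounded below
independently of `m` (`exists_le_fourierNormSq`, `exists_waveKernel_le`). For `α < 1` that lower
bound comes from the estimate near the origin; for `α = 1` it comes from the `k`-th angular Fourier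
coefficient of `f_k` on the circle, which has modulus `|J_k lam|`.
-/

noncomputable section

open MeasureTheory

/-! ### The roots of unity and the discrete Fourier transform of the plane waves -/

/-- The primitive root of unity `exp (2 π i / (2 m + 1))`. -/
def zetaRoot (m : ℕ) : ℂ :=
  Complex.exp (2 * Real.pi * Complex.I / ((2 * m + 1 : ℕ) : ℂ))

theorem zetaRoot_isPrimitiveRoot (m : ℕ) : IsPrimitiveRoot (zetaRoot m) (2 * m + 1) :=
  Complex.isPrimitiveRoot_exp _ (by omega)

theorem zetaRoot_ne_zero (m : ℕ) : zetaRoot m ≠ 0 := Complex.exp_ne_zero _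

theorem norm_zetaRoot (m : ℕ) : ‖zetaRoot m‖ = 1 :=
  (zetaRoot_isPrimitiveRoot m).norm'_eq_one (by omega)

theorem conj_zetaRoot (m : ℕ) : (starRingEnd ℂ) (zetaRoot m) = (zetaRoot m)⁻¹ :=
  (Complex.inv_eq_conj (norm_zetaRoot m)).symm

theorem zetaRoot_zpow (m : ℕ) (j : ℤ) :
    zetaRoot m ^ j = Complex.exp ((2 * j * Real.pi / (2 * m + 1) : ℝ) * Complex.I) := by
  rw [zetaRoot, ← Complex.exp_int_mul]
  congr 1
  push_cast
  ring

theorem sum_Icc_eq_sum_range {M : Type*} [AddCommMonoid M] (m : ℕ) (F : ℤ → M) :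
    ∑ j ∈ Finset.Icc (-(m : ℤ)) m, F j = ∑ i ∈ Finset.range (2 * m + 1), F ((i : ℤ) - m) := by
  symm
  refine Finset.sum_bij (fun i _ => (i : ℤ) - m) ?_ ?_ ?_ ?_
  · intro i hi
    rw [Finset.mem_range] at hi
    rw [Finset.mem_Icc]
    omega
  · intro i _ j _ h
    simpa using h
  · intro j hj
    rw [Finset.mem_Icc] at hj
    refine ⟨(j + m).toNat, ?_, ?_⟩
    · rw [Finset.mem_range]
      omega
    · omega
  · intro i _
    rfl

theorem sum_zetaRoot_zpow (m : ℕ) (d : ℤ) :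
    ∑ j ∈ Finset.Icc (-(m : ℤ)) m, zetaRoot m ^ (j * d) =
      if ((2 * m + 1 : ℕ) : ℤ) ∣ d then ((2 * m + 1 : ℕ) : ℂ) else 0 := by
  have hz := zetaRoot_isPrimitiveRoot m
  have h0 := zetaRoot_ne_zero m
  set q := zetaRoot m ^ d with hq
  have hq0 : q ≠ 0 := zpow_ne_zero _ h0
  have hpow : ∀ j : ℤ, zetaRoot m ^ (j * d) = q ^ j := by
    intro j
    rw [hq, ← zpow_mul, mul_comm]
  simp only [hpow]
  split_ifs with h
  · have : q = 1 := (hz.zpow_eq_one_iff_dvd d).2 h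
    simp only [this, one_zpow, Finset.sum_const, nsmul_eq_mul, mul_one, Int.card_Icc]
    congr 1
    omega
  · have hne : q ≠ 1 := fun h1 => h ((hz.zpow_eq_one_iff_dvd d).1 h1)
    rw [sum_Icc_eq_sum_range]
    have : ∀ i : ℕ, q ^ ((i : ℤ) - m) = q ^ i * (q ^ m)⁻¹ := by
      intro i
      rw [zpow_sub₀ hq0, zpow_natCast, zpow_natCast, div_eq_mul_inv]
    simp only [this]
    rw [← Finset.sum_mul, geom_sum_eq hne]
    have hN : q ^ (2 * m + 1) = 1 := by
      rw [hq, ← zpow_natCast, ← zpow_mul, mul_comm, zpow_mul, zpow_natCast, hz.pow_eq_one,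
        one_zpow]
    rw [hN]
    simp

/-- The point of the plane as a complex number. -/
def toComplex (x : Plane) : ℂ := ⟨x 0, x 1⟩

theorem norm_toComplex (x : Plane) : ‖toComplex x‖ = ‖x‖ := by
  rw [EuclideanSpace.norm_eq, Complex.norm_def, Complex.normSq_apply]
  simp [toComplex, Fin.sum_univ_two, sq]

/-- A plane wave factors into a holomorphic and an antiholomorphic exponential. -/
theorem planeWave_waveVector (lam : ℝ) (m : ℕ) (j : ℤ) (x : Plane) :
    planeWave (waveVector lam m j) x =
      Complex.exp (Complex.I * (lam / 2) * toComplex x * zetaRoot m ^ (-j)) *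
        Complex.exp (Complex.I * (lam / 2) * (starRingEnd ℂ) (toComplex x) * zetaRoot m ^ j) := by
  rw [← Complex.exp_add, planeWave]
  congr 1
  have hx : toComplex x = x 0 + x 1 * Complex.I := (Complex.mk_eq_add_mul_I _ _)
  have hc : (starRingEnd ℂ) (toComplex x) = x 0 - x 1 * Complex.I := by
    rw [hx]; simp [sub_eq_add_neg]
  rw [hc, hx, zetaRoot_zpow, zetaRoot_zpow]
  set t : ℝ := 2 * j * Real.pi / (2 * m + 1) with ht
  have hneg : (2 * ((-j : ℤ) : ℝ) * Real.pi / (2 * m + 1) : ℝ) = -t := by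
    rw [ht]; push_cast; ring
  rw [hneg, Complex.ofReal_neg, Complex.exp_mul_I, Complex.exp_mul_I, Complex.cos_neg,
    Complex.sin_neg]
  simp only [waveVector, PiLp.inner_apply, Fin.sum_univ_two, ← ht]
  simp
  linear_combination (Complex.I * lam * x 1 * Complex.sin t) * Complex.I_sq

/-- The `k`-th discrete Fourier coefficient of the family of plane waves. It is the part of
the wave `exp (i lam x₀)` whose angular frequencies are congruent to `k` modulo `2 m + 1`. -/
def fourierWave (lam : ℝ) (m : ℕ) (k : ℤ) (x : Plane) : ℂ :=
  ((2 * m + 1 : ℕ) : ℂ)⁻¹ *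
    ∑ j ∈ Finset.Icc (-(m : ℤ)) m, zetaRoot m ^ (j * k) * planeWave (waveVector lam m j) x

theorem norm_planeWave (k x : Plane) : ‖planeWave k x‖ = 1 := by
  rw [planeWave, mul_comm, Complex.norm_exp_ofReal_mul_I]

theorem continuous_planeWave (k : Plane) : Continuous (planeWave k) := by
  unfold planeWave
  fun_prop

theorem continuous_fourierWave (lam : ℝ) (m : ℕ) (k : ℤ) :
    Continuous (fourierWave lam m k) := by
  unfold fourierWave
  refine continuous_const.mul (continuous_finsetSum _ fun j _ => ?_)
  exact continuous_const.mul (continuous_planeWave _)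

theorem norm_fourierWave_le_one (lam : ℝ) (m : ℕ) (k : ℤ) (x : Plane) :
    ‖fourierWave lam m k x‖ ≤ 1 := by
  have hN : (0 : ℝ) < ((2 * m + 1 : ℕ) : ℝ) := by positivity
  rw [fourierWave, norm_mul, norm_inv, Complex.norm_natCast, inv_mul_le_iff₀ hN, mul_one]
  refine (norm_sum_le _ _).trans ?_
  have : ∀ j : ℤ, ‖zetaRoot m ^ (j * k) * planeWave (waveVector lam m j) x‖ = 1 := by
    intro j
    rw [norm_mul, norm_planeWave, norm_zpow, norm_zetaRoot, one_zpow, one_mul]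
  simp only [this, Finset.sum_const, nsmul_eq_mul, mul_one, Int.card_Icc]
  norm_cast
  omega

/-- Fourier inversion: the plane waves are combinations of their Fourier coefficients. -/
theorem planeWave_eq_sum_fourierWave (lam : ℝ) (m : ℕ) {l : ℤ}
    (hl : l ∈ Finset.Icc (-(m : ℤ)) m) (x : Plane) :
    planeWave (waveVector lam m l) x =
      ∑ k ∈ Finset.Icc (-(m : ℤ)) m, zetaRoot m ^ (-(l * k)) * fourierWave lam m k x := by
  have hN : ((2 * m + 1 : ℕ) : ℂ) ≠ 0 := Nat.cast_ne_zero.2 (by omega)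
  have h0 := zetaRoot_ne_zero m
  have h1 : ∀ k : ℤ, zetaRoot m ^ (-(l * k)) * fourierWave lam m k x =
      ∑ j ∈ Finset.Icc (-(m : ℤ)) m, ((2 * m + 1 : ℕ) : ℂ)⁻¹ *
        planeWave (waveVector lam m j) x * zetaRoot m ^ (k * (j - l)) := by
    intro k
    rw [fourierWave, Finset.mul_sum, Finset.mul_sum]
    refine Finset.sum_congr rfl fun j _ => ?_
    rw [show k * (j - l) = -(l * k) + j * k by ring, zpow_add₀ h0]
    ring
  simp only [h1]
  rw [Finset.sum_comm]
  simp only [← Finset.mul_sum, sum_zetaRoot_zpow]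
  rw [Finset.sum_eq_single l]
  · simp only [sub_self, dvd_zero, if_true]
    field_simp
  · intro j hj hjl
    rw [if_neg, mul_zero]
    rintro ⟨c, hc⟩
    rw [Finset.mem_Icc] at hj hl
    have h2 : c = 0 := by
      by_contra hc0
      rcases lt_or_gt_of_ne hc0 with h | h
      · have : ((2 * m + 1 : ℕ) : ℤ) * c ≤ ((2 * m + 1 : ℕ) : ℤ) * (-1) :=
          mul_le_mul_of_nonneg_left (by omega) (by positivity)
        push_cast at *
        linarith
      · have : ((2 * m + 1 : ℕ) : ℤ) * 1 ≤ ((2 * m + 1 : ℕ) : ℤ) * c :=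
          mul_le_mul_of_nonneg_left (by omega) (by positivity)
        push_cast at *
        linarith
    rw [h2] at hc
    omega
  · intro h
    exact absurd hl h

theorem span_fourierWave (lam : ℝ) (m : ℕ) :
    Submodule.span ℂ (fourierWave lam m '' Set.Icc (-(m : ℤ)) m) = planeWaveSpace lam m := by
  apply le_antisymm
  · rw [Submodule.span_le]
    rintro _ ⟨k, -, rfl⟩
    have : fourierWave lam m k = ((2 * m + 1 : ℕ) : ℂ)⁻¹ •
        ∑ j ∈ Finset.Icc (-(m : ℤ)) m, zetaRoot m ^ (j * k) • planeWave (waveVector lam m j) := by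
      funext x
      simp [fourierWave]
    rw [this]
    refine Submodule.smul_mem _ _ (Submodule.sum_mem _ fun j hj => Submodule.smul_mem _ _ ?_)
    exact Submodule.subset_span ⟨j, Finset.mem_Icc.1 hj, rfl⟩
  · rw [planeWaveSpace, Submodule.span_le]
    rintro _ ⟨l, hl, rfl⟩
    have : planeWave (waveVector lam m l) =
        ∑ k ∈ Finset.Icc (-(m : ℤ)) m, zetaRoot m ^ (-(l * k)) • fourierWave lam m k := by
      funext x
      simpa using planeWave_eq_sum_fourierWave lam m (Finset.mem_Icc.2 hl) x
    simp only [SetLike.mem_coe]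
    rw [this]
    refine Submodule.sum_mem _ fun j hj => Submodule.smul_mem _ _ ?_
    exact Submodule.subset_span ⟨j, Finset.mem_Icc.1 hj, rfl⟩

/-! ### Power series of the Fourier coefficients -/

theorem HasSum.congr_fun' {ι E : Type*} [AddCommMonoid E] [TopologicalSpace E] {f g : ι → E}
    {a : E} (hf : HasSum f a) (h : ∀ i, g i = f i) : HasSum g a := by
  rwa [show g = f from funext h]

theorem HasSum.mul_real_of_nonneg {f g : ℕ → ℝ} {a b : ℝ} (hf : HasSum f a) (hg : HasSum g b)
    (hf0 : ∀ i, 0 ≤ f i) (hg0 : ∀ i, 0 ≤ g i) :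
    HasSum (fun p : ℕ × ℕ => f p.1 * g p.2) (a * b) :=
  hf.mul hg (hf.summable.mul_of_nonneg hg.summable hf0 hg0)

theorem Complex.hasSum_exp_div_factorial (u : ℂ) :
    HasSum (fun a : ℕ => u ^ a / (a.factorial : ℂ)) (Complex.exp u) := by
  rw [Complex.exp_eq_exp_ℂ]
  exact NormedSpace.expSeries_div_hasSum_exp u

theorem Real.hasSum_exp_div_factorial (s : ℝ) :
    HasSum (fun a : ℕ => s ^ a / (a.factorial : ℝ)) (Real.exp s) := by
  rw [Real.exp_eq_exp_ℝ]
  exact NormedSpace.expSeries_div_hasSum_exp s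

theorem Complex.hasSum_exp_mul_exp (u v : ℂ) :
    HasSum (fun p : ℕ × ℕ => u ^ p.1 / (p.1.factorial : ℂ) * (v ^ p.2 / (p.2.factorial : ℂ)))
      (Complex.exp u * Complex.exp v) := by
  have h1 := NormedSpace.norm_expSeries_div_summable u
  have h2 := NormedSpace.norm_expSeries_div_summable v
  have h3 := (summable_mul_of_summable_norm h1 h2).hasSum
  rw [← tsum_mul_tsum_of_summable_norm h1 h2, (Complex.hasSum_exp_div_factorial u).tsum_eq,
    (Complex.hasSum_exp_div_factorial v).tsum_eq] at h3
  exact h3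

/-- Only the monomials `z ^ a * conj z ^ b` of angular frequency `a - b ≡ k` modulo `2 m + 1`
survive in the `k`-th Fourier coefficient. -/
theorem hasSum_fourierWave (lam : ℝ) (m : ℕ) (k : ℤ) (x : Plane) :
    HasSum (fun p : ℕ × ℕ => if ((2 * m + 1 : ℕ) : ℤ) ∣ k - p.1 + p.2 then
      (Complex.I * (lam / 2) * toComplex x) ^ p.1 / (p.1.factorial : ℂ) *
        ((Complex.I * (lam / 2) * (starRingEnd ℂ) (toComplex x)) ^ p.2 / (p.2.factorial : ℂ))
      else 0) (fourierWave lam m k x) := by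
  set u := Complex.I * (lam / 2) * toComplex x with hu
  set v := Complex.I * (lam / 2) * (starRingEnd ℂ) (toComplex x) with hv
  have hN : ((2 * m + 1 : ℕ) : ℂ) ≠ 0 := Nat.cast_ne_zero.2 (by omega)
  have h0 := zetaRoot_ne_zero m
  have key : ∀ j : ℤ, HasSum (fun p : ℕ × ℕ => (u * zetaRoot m ^ (-j)) ^ p.1 / (p.1.factorial : ℂ) *
      ((v * zetaRoot m ^ j) ^ p.2 / (p.2.factorial : ℂ))) (planeWave (waveVector lam m j) x) := by
    intro j
    rw [planeWave_waveVector, ← hu, ← hv]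
    exact Complex.hasSum_exp_mul_exp _ _
  have h2 := (hasSum_sum (s := Finset.Icc (-(m : ℤ)) m)
    (fun j _ => (key j).mul_left (zetaRoot m ^ (j * k)))).mul_left (((2 * m + 1 : ℕ) : ℂ)⁻¹)
  refine h2.congr_fun' fun p => ?_
  have h3 : ∀ j : ℤ, zetaRoot m ^ (j * k) * ((u * zetaRoot m ^ (-j)) ^ p.1 / (p.1.factorial : ℂ) *
      ((v * zetaRoot m ^ j) ^ p.2 / (p.2.factorial : ℂ))) =
      (u ^ p.1 / (p.1.factorial : ℂ) * (v ^ p.2 / (p.2.factorial : ℂ))) *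
        zetaRoot m ^ (j * (k - p.1 + p.2)) := by
    intro j
    rw [show j * (k - p.1 + p.2) = j * k + (-j) * p.1 + j * p.2 by ring, zpow_add₀ h0,
      zpow_add₀ h0, zpow_mul _ (-j), zpow_mul _ j (p.2 : ℤ), zpow_natCast, zpow_natCast, mul_pow,
      mul_pow]
    ring
  simp only [h3]
  rw [← Finset.mul_sum, sum_zetaRoot_zpow]
  split_ifs
  · field_simp
  · simp

/-- The rotation by `2 π / (2 m + 1)` multiplies `fourierWave lam m k` by `zetaRoot m ^ k`. -/
theorem fourierWave_rotate (lam : ℝ) (m : ℕ) (k : ℤ) {x y : Plane}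
    (hxy : toComplex y = zetaRoot m * toComplex x) :
    fourierWave lam m k y = zetaRoot m ^ k * fourierWave lam m k x := by
  refine (hasSum_fourierWave lam m k y).unique ?_
  refine ((hasSum_fourierWave lam m k x).mul_left (zetaRoot m ^ k)).congr_fun' fun p => ?_
  have h0 := zetaRoot_ne_zero m
  split_ifs with h
  · have h1 : zetaRoot m ^ (k - p.1 + p.2) = 1 :=
      ((zetaRoot_isPrimitiveRoot m).zpow_eq_one_iff_dvd _).2 h
    have h2 : zetaRoot m ^ k = zetaRoot m ^ p.1 * ((zetaRoot m)⁻¹) ^ p.2 := by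
      rw [show k = (k - p.1 + p.2) + p.1 + (-p.2) by ring, zpow_add₀ h0, zpow_add₀ h0, h1,
        one_mul, zpow_natCast, zpow_neg, zpow_natCast, inv_pow]
    rw [hxy, map_mul, conj_zetaRoot, h2]
    ring
  · simp

/-- The tail of the exponential series, as a series over all of `ℕ`. -/
theorem exists_hasSum_exp_tail (s : ℝ) (hs : 0 ≤ s) (n : ℕ) :
    ∃ T : ℝ, HasSum (fun a : ℕ => if n < a then s ^ a / (a.factorial : ℝ) else 0) T ∧
      T ≤ s ^ (n + 1) / ((n + 1).factorial : ℝ) * Real.exp s := by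
  have hsum := Real.hasSum_exp_div_factorial s
  have hS : Summable (fun a : ℕ => if n < a then s ^ a / (a.factorial : ℝ) else 0) := by
    refine Summable.of_nonneg_of_le ?_ ?_ hsum.summable
    · intro a
      split_ifs <;> positivity
    · intro a
      split_ifs
      · exact le_rfl
      · positivity
  refine ⟨_, hS.hasSum, ?_⟩
  have h2 := (hasSum_nat_add_iff' (n + 1)).2 hS.hasSum
  have h3 : ∑ i ∈ Finset.range (n + 1),
      (if n < i then s ^ i / (i.factorial : ℝ) else 0) = 0 := by
    refine Finset.sum_eq_zero fun i hi => ?_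
    rw [Finset.mem_range] at hi
    rw [if_neg (by omega)]
  rw [h3, sub_zero] at h2
  refine hasSum_le ?_ h2 (hsum.mul_left (s ^ (n + 1) / ((n + 1).factorial : ℝ)))
  intro a
  rw [if_pos (by omega), div_mul_div_comm, ← pow_add, add_comm a]
  have hd : (n + 1).factorial * a.factorial ≤ (n + 1 + a).factorial :=
    Nat.le_of_dvd (Nat.factorial_pos _) (Nat.factorial_mul_factorial_dvd_factorial_add _ _)
  have hd' : ((n + 1).factorial : ℝ) * (a.factorial : ℝ) ≤ ((n + 1 + a).factorial : ℝ) := by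
    exact_mod_cast hd
  have : (0 : ℝ) < ((n + 1).factorial : ℝ) * (a.factorial : ℝ) := by positivity
  gcongr

/-- The modulus `(lam r / 2) ^ n / n!` of the leading monomial of a Fourier coefficient of
frequency `± n` at distance `r` from the origin. -/
def leadTerm (lam : ℝ) (n : ℕ) (r : ℝ) : ℝ := (lam / 2 * r) ^ n / (n.factorial : ℝ)

theorem leadTerm_nonneg {lam : ℝ} (hlam : 0 < lam) (n : ℕ) {r : ℝ} (hr : 0 ≤ r) :
    0 ≤ leadTerm lam n r := by unfold leadTerm; positivity

theorem leadTerm_pos {lam : ℝ} (hlam : 0 < lam) (n : ℕ) {r : ℝ} (hr : 0 < r) :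
    0 < leadTerm lam n r := by unfold leadTerm; positivity

theorem leadTerm_eq (lam : ℝ) (n : ℕ) (r : ℝ) :
    leadTerm lam n r = leadTerm lam n 1 * r ^ n := by
  unfold leadTerm; rw [mul_pow, mul_pow]; ring

/-- If the terms of a double series other than one are dominated by those of `exp s * exp s`, and
vanish unless one index exceeds `n`, then that one term approximates the sum. -/
theorem norm_sub_le_of_exp_tail {F : ℕ × ℕ → ℂ} {f : ℂ} (hF : HasSum F f) {s : ℝ} (hs : 0 ≤ s)
    (n : ℕ) (p₀ : ℕ × ℕ)
    (hle : ∀ p, ‖F p‖ ≤ s ^ p.1 / (p.1.factorial : ℝ) * (s ^ p.2 / (p.2.factorial : ℝ)))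
    (hzero : ∀ p, p ≠ p₀ → p.1 ≤ n → p.2 ≤ n → F p = 0) :
    ‖f - F p₀‖ ≤ 2 * (s ^ (n + 1) / ((n + 1).factorial : ℝ) * Real.exp s) * Real.exp s := by
  obtain ⟨T, hT, hTle⟩ := exists_hasSum_exp_tail s hs n
  have hexp := Real.hasSum_exp_div_factorial s
  have hpos1 : ∀ a : ℕ, 0 ≤ s ^ a / (a.factorial : ℝ) := fun a => by positivity
  have hpos2 : ∀ a : ℕ, 0 ≤ (if n < a then s ^ a / (a.factorial : ℝ) else 0) := fun a => by
    split_ifs <;> positivity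
  have hG1 := hT.mul_real_of_nonneg hexp hpos2 hpos1
  have hG2 := hexp.mul_real_of_nonneg hT hpos1 hpos2
  have hG := hG1.add hG2
  have hdiff : HasSum (fun p => F p - if p = p₀ then F p₀ else 0) (f - F p₀) :=
    hF.sub (hasSum_ite_eq p₀ (F p₀))
  have hbound : ‖f - F p₀‖ ≤ T * Real.exp s + Real.exp s * T := by
    refine hdiff.norm_le_of_bounded hG fun p => ?_
    have hnn : 0 ≤ (if n < p.1 then s ^ p.1 / (p.1.factorial : ℝ) else 0) *
        (s ^ p.2 / (p.2.factorial : ℝ)) := mul_nonneg (hpos2 _) (hpos1 _)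
    have hnn' : 0 ≤ (s ^ p.1 / (p.1.factorial : ℝ)) *
        (if n < p.2 then s ^ p.2 / (p.2.factorial : ℝ) else 0) := mul_nonneg (hpos1 _) (hpos2 _)
    by_cases hp : p = p₀
    · rw [if_pos hp, hp, sub_self, norm_zero, ← hp]
      exact add_nonneg hnn hnn'
    · rw [if_neg hp, sub_zero]
      by_cases h1 : n < p.1
      · refine le_add_of_le_of_nonneg ?_ hnn'
        rw [if_pos h1]
        exact hle p
      · by_cases h2 : n < p.2
        · refine le_add_of_nonneg_of_le hnn ?_
          rw [if_pos h2]
          exact hle p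
        · rw [hzero p hp (not_lt.1 h1) (not_lt.1 h2), norm_zero]
          exact add_nonneg hnn hnn'
  calc ‖f - F p₀‖ ≤ 2 * T * Real.exp s := by linarith
    _ ≤ _ := by gcongr

/-- In the power series of `fourierWave lam m k`, `|k| ≤ m`, every monomial `z ^ a * conj z ^ b`
other than `z ^ k` (or `conj z ^ (-k)`) has `a > |k|` or `b > |k|`; hence the leading monomial
dominates, with a relative error `O (|x| / (|k| + 1))` that does not depend on `m`. -/
theorem abs_norm_fourierWave_sub_leadTerm_le {lam : ℝ} (hlam : 0 < lam) (m : ℕ) (k : ℤ)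
    (hk : k.natAbs ≤ m) {x : Plane} (hx : ‖x‖ ≤ 1) :
    |‖fourierWave lam m k x‖ - leadTerm lam k.natAbs ‖x‖| ≤
      leadTerm lam k.natAbs ‖x‖ * (‖x‖ * (lam * Real.exp lam) / (k.natAbs + 1)) := by
  obtain ⟨n, hn⟩ : ∃ n, n = k.natAbs := ⟨_, rfl⟩
  obtain ⟨s, hs⟩ : ∃ s, s = lam / 2 * ‖x‖ := ⟨_, rfl⟩
  obtain ⟨u, hu⟩ : ∃ u, u = Complex.I * (lam / 2) * toComplex x := ⟨_, rfl⟩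
  obtain ⟨v, hv⟩ : ∃ v, v = Complex.I * (lam / 2) * (starRingEnd ℂ) (toComplex x) := ⟨_, rfl⟩
  have hs0 : 0 ≤ s := by rw [hs]; positivity
  have hlam2 : ‖(lam / 2 : ℂ)‖ = lam / 2 := by
    rw [norm_div, Complex.norm_real, Real.norm_of_nonneg hlam.le]
    simp
  have hnu : ‖u‖ = s := by
    rw [hu, norm_mul, norm_mul, norm_toComplex, Complex.norm_I, one_mul, hlam2, hs]
  have hnv : ‖v‖ = s := by
    rw [hv, norm_mul, norm_mul, RCLike.norm_conj, norm_toComplex, Complex.norm_I, one_mul, hlam2,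
      hs]
  have hsum := hasSum_fourierWave lam m k x
  rw [← hu, ← hv] at hsum
  have hmon : ∀ p : ℕ × ℕ, ‖u ^ p.1 / (p.1.factorial : ℂ) * (v ^ p.2 / (p.2.factorial : ℂ))‖ =
      s ^ p.1 / (p.1.factorial : ℝ) * (s ^ p.2 / (p.2.factorial : ℝ)) := by
    intro p
    rw [norm_mul, norm_div, norm_div, norm_pow, norm_pow, hnu, hnv, Complex.norm_natCast,
      Complex.norm_natCast]
  have hbound := norm_sub_le_of_exp_tail hsum hs0 n (k.toNat, (-k).toNat)
    (by
      intro p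
      split_ifs
      · exact (hmon p).le
      · rw [norm_zero]; positivity)
    (by
      rintro ⟨a, b⟩ hp ha hb
      refine if_neg fun hd => hp ?_
      -- `|k - a + b| ≤ 2 |k| < 2 m + 1`, so the congruence is an equality.
      have h0 : k - a + b = 0 := by
        refine Int.eq_zero_of_abs_lt_dvd hd ?_
        rw [abs_lt]
        simp only at ha hb
        constructor <;> omega
      rw [Prod.mk.injEq]
      simp only at ha hb
      omega)
  have hd0 : ((2 * m + 1 : ℕ) : ℤ) ∣ k - (k.toNat : ℤ) + ((-k).toNat : ℤ) := by
    rw [show k - (k.toNat : ℤ) + ((-k).toNat : ℤ) = 0 by omega]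
    exact dvd_zero _
  rw [if_pos hd0] at hbound
  have hlead := hmon (k.toNat, (-k).toNat)
  have hlead' : s ^ k.toNat / (k.toNat.factorial : ℝ) *
      (s ^ (-k).toNat / ((-k).toNat.factorial : ℝ)) = leadTerm lam n ‖x‖ := by
    rw [leadTerm, ← hs]
    rcases le_total 0 k with h | h
    · have h1 : k.toNat = n := by omega
      have h2 : (-k).toNat = 0 := by omega
      rw [h1, h2]; simp
    · have h1 : (-k).toNat = n := by omega
      have h2 : k.toNat = 0 := by omega
      rw [h1, h2]; simp
  rw [← hn, ← hlead', ← hlead, hlead, hlead']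
  have habs := abs_norm_sub_norm_le (fourierWave lam m k x)
    (u ^ k.toNat / (k.toNat.factorial : ℂ) * (v ^ (-k).toNat / ((-k).toNat.factorial : ℂ)))
  rw [hlead, hlead'] at habs
  refine habs.trans (hbound.trans ?_)
  have hsle : 2 * s ≤ lam := by
    rw [hs]
    nlinarith
  calc 2 * (s ^ (n + 1) / ((n + 1).factorial : ℝ) * Real.exp s) * Real.exp s
      = leadTerm lam n ‖x‖ * (‖x‖ * (lam * Real.exp (2 * s)) / (n + 1)) := by
        have h2s : ‖x‖ * lam = 2 * s := by rw [hs]; ring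
        rw [two_mul s, Real.exp_add, leadTerm, ← hs, Nat.factorial_succ, pow_succ, ← mul_assoc ‖x‖,
          h2s]
        push_cast
        field_simp
    _ ≤ _ := by
        have := leadTerm_nonneg hlam n (norm_nonneg x)
        gcongr

/-! ### The sampling measure -/

/-- The point of angle `t` on the unit circle. -/
def circlePoint (t : ℝ) : Plane := !₂[Real.cos t, Real.sin t]

theorem toComplex_circlePoint (t : ℝ) :
    toComplex (circlePoint t) = Complex.exp (t * Complex.I) := by
  rw [Complex.exp_mul_I, ← Complex.ofReal_cos, ← Complex.ofReal_sin, toComplex,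
    Complex.mk_eq_add_mul_I]
  simp [circlePoint]

theorem norm_circlePoint (t : ℝ) : ‖circlePoint t‖ = 1 := by
  rw [← norm_toComplex, toComplex_circlePoint, Complex.norm_exp_ofReal_mul_I]

theorem continuous_circlePoint : Continuous circlePoint := by
  unfold circlePoint
  refine (PiLp.continuous_toLp 2 _).comp (continuous_pi fun i => ?_)
  fin_cases i
  · exact Real.continuous_cos
  · exact Real.continuous_sin

theorem circlePoint_periodic : Function.Periodic circlePoint (2 * Real.pi) := by
  intro t
  simp [circlePoint]

theorem toComplex_injective : Function.Injective toComplex := by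
  intro x y h
  ext i
  fin_cases i
  · exact congrArg Complex.re h
  · exact congrArg Complex.im h

/-- The rotation of the plane by the angle `θ`. -/
def planeRotation (θ : ℝ) : Plane →ₗᵢ[ℝ] Plane where
  toFun x := !₂[Real.cos θ * x 0 - Real.sin θ * x 1, Real.sin θ * x 0 + Real.cos θ * x 1]
  map_add' x y := by
    ext i
    fin_cases i <;> simp <;> ring
  map_smul' c x := by
    ext i
    fin_cases i <;> simp <;> ring
  norm_map' x := by
    simp only [LinearMap.coe_mk, AddHom.coe_mk]
    rw [EuclideanSpace.norm_eq, EuclideanSpace.norm_eq]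
    congr 1
    simp only [Fin.sum_univ_two, Real.norm_eq_abs, sq_abs]
    simp
    linear_combination (x 0 ^ 2 + x 1 ^ 2) * Real.cos_sq_add_sin_sq θ

theorem toComplex_planeRotation (θ : ℝ) (x : Plane) :
    toComplex (planeRotation θ x) = Complex.exp (θ * Complex.I) * toComplex x := by
  rw [Complex.exp_mul_I, ← Complex.ofReal_cos, ← Complex.ofReal_sin]
  apply Complex.ext
  · simp [-Complex.ofReal_cos, -Complex.ofReal_sin, toComplex, planeRotation]
  · simp [-Complex.ofReal_cos, -Complex.ofReal_sin, toComplex, planeRotation]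
    ring

theorem planeRotation_circlePoint (θ t : ℝ) :
    planeRotation θ (circlePoint t) = circlePoint (t + θ) := by
  apply toComplex_injective
  rw [toComplex_planeRotation, toComplex_circlePoint, toComplex_circlePoint, ← Complex.exp_add]
  congr 1
  push_cast
  ring

theorem mem_unitDisc {x : Plane} : x ∈ unitDisc ↔ ‖x‖ ≤ 1 := mem_closedBall_zero_iff

theorem volume_unitDisc_ne_zero : volume unitDisc ≠ 0 :=
  (Metric.measure_closedBall_pos volume (0 : Plane) one_pos).ne'

theorem volume_unitDisc_ne_top : volume unitDisc ≠ ⊤ :=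
  (isCompact_closedBall (0 : Plane) 1).measure_ne_top

theorem volume_real_unitDisc_pos : 0 < volume.real unitDisc :=
  ENNReal.toReal_pos volume_unitDisc_ne_zero volume_unitDisc_ne_top

theorem arcLength_eq_map :
    arcLength = Measure.map circlePoint (volume.restrict (Set.Ioc (-Real.pi) Real.pi)) := rfl

theorem arcLength_univ : arcLength Set.univ = ENNReal.ofReal (2 * Real.pi) := by
  rw [arcLength_eq_map, Measure.map_apply continuous_circlePoint.measurable MeasurableSet.univ]
  simp only [Set.preimage_univ, Measure.restrict_apply_univ, Real.volume_Ioc]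
  congr 1
  ring

instance : IsFiniteMeasure arcLength := ⟨by rw [arcLength_univ]; exact ENNReal.ofReal_lt_top⟩

instance : IsFiniteMeasure (volume.restrict unitDisc) :=
  ⟨by rw [Measure.restrict_apply_univ]; exact volume_unitDisc_ne_top.lt_top⟩

theorem discWeight_ne_top (α : ℝ) : ENNReal.ofReal (1 - α) * (volume unitDisc)⁻¹ ≠ ⊤ :=
  ENNReal.mul_ne_top ENNReal.ofReal_ne_top (ENNReal.inv_ne_top.2 volume_unitDisc_ne_zero)

theorem arcWeight_ne_top (α : ℝ) : ENNReal.ofReal α * (arcLength Set.univ)⁻¹ ≠ ⊤ := by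
  refine ENNReal.mul_ne_top ENNReal.ofReal_ne_top (ENNReal.inv_ne_top.2 ?_)
  rw [arcLength_univ]
  exact (ENNReal.ofReal_pos.2 Real.two_pi_pos).ne'

instance (α : ℝ) : IsFiniteMeasure (samplingMeasure α) := by
  have h1 := Measure.smul_finite (volume.restrict unitDisc) (discWeight_ne_top α)
  have h2 := Measure.smul_finite arcLength (arcWeight_ne_top α)
  unfold samplingMeasure
  infer_instance

section Integral

variable {E : Type*} [NormedAddCommGroup E]

theorem Continuous.integrable_restrict_unitDisc {g : Plane → E} (hg : Continuous g) :
    Integrable g (volume.restrict unitDisc) :=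
  hg.continuousOn.integrableOn_compact (isCompact_closedBall _ _)

theorem Continuous.integrable_arcLength {g : Plane → E} (hg : Continuous g) :
    Integrable g arcLength := by
  have : Integrable (g ∘ circlePoint) (volume.restrict (Set.Ioc (-Real.pi) Real.pi)) :=
    ((hg.comp continuous_circlePoint).continuousOn.integrableOn_compact
      (isCompact_Icc (a := -Real.pi) (b := Real.pi))).mono_set Set.Ioc_subset_Icc_self
  exact (integrable_map_measure hg.aestronglyMeasurable
    continuous_circlePoint.measurable.aemeasurable).2 this

variable [NormedSpace ℝ E]

theorem integral_samplingMeasure {α : ℝ} (h0 : 0 ≤ α) (h1 : α ≤ 1) {g : Plane → E}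
    (hg : Continuous g) :
    ∫ x, g x ∂(samplingMeasure α) =
      ((1 - α) * (volume.real unitDisc)⁻¹) • (∫ x in unitDisc, g x) +
        (α * (2 * Real.pi)⁻¹) • ∫ t in -Real.pi..Real.pi, g (circlePoint t) := by
  rw [samplingMeasure, integral_add_measure
    (hg.integrable_restrict_unitDisc.smul_measure (discWeight_ne_top α))
    (hg.integrable_arcLength.smul_measure (arcWeight_ne_top α)),
    integral_smul_measure, integral_smul_measure]
  congr 1
  · rw [ENNReal.toReal_mul, ENNReal.toReal_ofReal (by linarith), ENNReal.toReal_inv]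
    rfl
  · congr 1
    · rw [arcLength_univ, ENNReal.toReal_mul, ENNReal.toReal_ofReal h0, ENNReal.toReal_inv,
        ENNReal.toReal_ofReal Real.two_pi_pos.le]
    rw [intervalIntegral.integral_of_le (by linarith [Real.pi_pos]), arcLength_eq_map]
    exact integral_map continuous_circlePoint.measurable.aemeasurable hg.aestronglyMeasurable

theorem integral_comp_planeRotation_unitDisc (θ : ℝ) (g : Plane → E) :
    ∫ x in unitDisc, g (planeRotation θ x) = ∫ x in unitDisc, g x := by
  set R : Plane ≃ₗᵢ[ℝ] Plane := (planeRotation θ).toLinearIsometryEquiv rfl with hR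
  have hpre : R ⁻¹' unitDisc = unitDisc := by
    ext x
    simp [unitDisc]
  have := R.measurePreserving.setIntegral_preimage_emb R.toMeasurableEquiv.measurableEmbedding
    g unitDisc
  rw [hpre] at this
  exact this

theorem integral_comp_planeRotation {α : ℝ} (h0 : 0 ≤ α) (h1 : α ≤ 1) (θ : ℝ) {g : Plane → E}
    (hg : Continuous g) :
    ∫ x, g (planeRotation θ x) ∂(samplingMeasure α) = ∫ x, g x ∂(samplingMeasure α) := by
  rw [integral_samplingMeasure h0 h1 hg,
    integral_samplingMeasure h0 h1 (g := fun x => g (planeRotation θ x))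
      (hg.comp (planeRotation θ).continuous),
    integral_comp_planeRotation_unitDisc]
  congr 2
  simp only [planeRotation_circlePoint]
  rw [intervalIntegral.integral_comp_add_right (fun t => g (circlePoint t))]
  have hper : Function.Periodic (fun t => g (circlePoint t)) (2 * Real.pi) := fun t => by
    simp only [circlePoint_periodic t]
  have := hper.intervalIntegral_add_eq (-Real.pi + θ) (-Real.pi)
  rw [show -Real.pi + 2 * Real.pi = Real.pi by ring,
    show -Real.pi + θ + 2 * Real.pi = Real.pi + θ by ring] at this
  exact this

end Integral

theorem disc_integral_le_integral_samplingMeasure {α : ℝ} (h0 : 0 ≤ α) (h1 : α ≤ 1)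
    {g : Plane → ℝ} (hg : Continuous g) (hg0 : ∀ x, 0 ≤ g x) :
    (1 - α) * (volume.real unitDisc)⁻¹ * (∫ x in unitDisc, g x) ≤
      ∫ x, g x ∂(samplingMeasure α) := by
  rw [integral_samplingMeasure h0 h1 hg, smul_eq_mul, smul_eq_mul]
  have : 0 ≤ ∫ t in -Real.pi..Real.pi, g (circlePoint t) :=
    intervalIntegral.integral_nonneg (by linarith [Real.pi_pos]) fun t _ => hg0 _
  have := mul_nonneg (mul_nonneg h0 (inv_nonneg.2 Real.two_pi_pos.le)) this
  linarith

theorem circle_integral_le_integral_samplingMeasure {α : ℝ} (h0 : 0 ≤ α) (h1 : α ≤ 1)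
    {g : Plane → ℝ} (hg : Continuous g) (hg0 : ∀ x, 0 ≤ g x) :
    α * (2 * Real.pi)⁻¹ * (∫ t in -Real.pi..Real.pi, g (circlePoint t)) ≤
      ∫ x, g x ∂(samplingMeasure α) := by
  rw [integral_samplingMeasure h0 h1 hg, smul_eq_mul, smul_eq_mul]
  have h2 : 0 ≤ ∫ x in unitDisc, g x := integral_nonneg hg0
  have := mul_nonneg (mul_nonneg (sub_nonneg.2 h1)
    (inv_nonneg.2 volume_real_unitDisc_pos.le)) h2
  linarith

/-- A function that is at least `c` on the unit circle has mean at least `α * c`. -/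
theorem mul_le_integral_samplingMeasure {α : ℝ} (h0 : 0 ≤ α) (h1 : α ≤ 1)
    {g : Plane → ℝ} (hg : Continuous g) (hg0 : ∀ x, 0 ≤ g x) {c : ℝ}
    (hc : ∀ x, ‖x‖ = 1 → c ≤ g x) :
    α * c ≤ ∫ x, g x ∂(samplingMeasure α) := by
  refine le_trans ?_ (circle_integral_le_integral_samplingMeasure h0 h1 hg hg0)
  have hle : ∫ _ in -Real.pi..Real.pi, c ≤ ∫ t in -Real.pi..Real.pi, g (circlePoint t) := by
    refine intervalIntegral.integral_mono_on (by linarith [Real.pi_pos]) (by simp) ?_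
      fun t _ => hc _ (norm_circlePoint t)
    exact (hg.comp continuous_circlePoint).intervalIntegrable _ _
  rw [intervalIntegral.integral_const, smul_eq_mul] at hle
  rw [mul_assoc]
  refine mul_le_mul_of_nonneg_left ?_ h0
  rw [le_inv_mul_iff₀ Real.two_pi_pos]
  linarith

/-- The mean of `‖x‖ ^ (2 n)` over the unit disc. -/
theorem integral_unitDisc_norm_pow (n : ℕ) :
    ∫ x in unitDisc, ‖x‖ ^ (2 * n) = volume.real unitDisc / (n + 1) := by
  have h := integral_fun_norm_addHaar (volume : Measure Plane)
    (Set.indicator (Set.Iic (1 : ℝ)) fun r => r ^ (2 * n))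
  have h1 : ∀ x : Plane, Set.indicator (Set.Iic (1 : ℝ)) (fun r => r ^ (2 * n)) ‖x‖ =
      Set.indicator unitDisc (fun x : Plane => ‖x‖ ^ (2 * n)) x := by
    intro x
    by_cases hx : ‖x‖ ≤ 1
    · rw [Set.indicator_of_mem (Set.mem_Iic.2 hx), Set.indicator_of_mem (mem_unitDisc.2 hx)]
    · rw [Set.indicator_of_notMem (fun h => hx (Set.mem_Iic.1 h)),
        Set.indicator_of_notMem (fun h => hx (mem_unitDisc.1 h))]
  simp only [h1] at h
  have hmeas : MeasurableSet unitDisc := Metric.isClosed_closedBall.measurableSet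
  rw [integral_indicator hmeas] at h
  rw [h]
  have hdim : Module.finrank ℝ Plane = 2 := by simp [Plane]
  have h2 : ∀ r : ℝ, r ^ (Module.finrank ℝ Plane - 1) •
      Set.indicator (Set.Iic (1 : ℝ)) (fun r => r ^ (2 * n)) r =
      Set.indicator (Set.Iic (1 : ℝ)) (fun r => r ^ (2 * n + 1)) r := by
    intro r
    rw [hdim]
    by_cases hr : r ≤ 1
    · rw [Set.indicator_of_mem (Set.mem_Iic.2 hr), Set.indicator_of_mem (Set.mem_Iic.2 hr),
        smul_eq_mul]
      ring
    · have hr' : r ∉ Set.Iic (1 : ℝ) := hr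
      rw [Set.indicator_of_notMem hr', Set.indicator_of_notMem hr', smul_zero]
  simp only [h2]
  rw [setIntegral_indicator measurableSet_Iic, Set.Ioi_inter_Iic,
    ← intervalIntegral.integral_of_le zero_le_one, integral_pow, hdim]
  have hball : volume.real (Metric.ball (0 : Plane) 1) = volume.real unitDisc := by
    rw [unitDisc, Measure.real, Measure.real, Measure.addHaar_closedBall_eq_addHaar_ball]
  rw [hball]
  have : (n : ℝ) + 1 ≠ 0 := by positivity
  simp
  field_simp
  ring

/-! ### Orthogonality and norms of the Fourier coefficients -/

/-- The squared norm of the `k`-th Fourier coefficient in `L²` of the sampling measure. -/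
def fourierNormSq (lam α : ℝ) (m : ℕ) (k : ℤ) : ℝ :=
  ∫ x, ‖fourierWave lam m k x‖ ^ 2 ∂(samplingMeasure α)

theorem continuous_fourierWave_normSq (lam : ℝ) (m : ℕ) (k : ℤ) :
    Continuous fun x => ‖fourierWave lam m k x‖ ^ 2 :=
  (continuous_fourierWave lam m k).norm.pow 2

/-- The Fourier coefficients are characters of the rotation group of order `2 m + 1`, which
preserves the sampling measure; so distinct ones are orthogonal. -/
theorem integral_fourierWave_mul_conj {α : ℝ} (h0 : 0 ≤ α) (h1 : α ≤ 1) (lam : ℝ) (m : ℕ)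
    {k l : ℤ} (hk : k ∈ Finset.Icc (-(m : ℤ)) m) (hl : l ∈ Finset.Icc (-(m : ℤ)) m)
    (hkl : k ≠ l) :
    ∫ x, fourierWave lam m k x * (starRingEnd ℂ) (fourierWave lam m l x) ∂(samplingMeasure α)
      = 0 := by
  have hcont : Continuous fun x =>
      fourierWave lam m k x * (starRingEnd ℂ) (fourierWave lam m l x) :=
    (continuous_fourierWave lam m k).mul
      (Complex.continuous_conj.comp (continuous_fourierWave lam m l))
  have hrot := integral_comp_planeRotation h0 h1 (2 * (1 : ℤ) * Real.pi / (2 * m + 1)) hcont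
  have hz : ∀ x, toComplex (planeRotation (2 * (1 : ℤ) * Real.pi / (2 * m + 1)) x) =
      zetaRoot m * toComplex x := by
    intro x
    rw [toComplex_planeRotation, ← zetaRoot_zpow, zpow_one]
  have hval : ∀ x, fourierWave lam m k (planeRotation (2 * (1 : ℤ) * Real.pi / (2 * m + 1)) x) *
      (starRingEnd ℂ) (fourierWave lam m l
        (planeRotation (2 * (1 : ℤ) * Real.pi / (2 * m + 1)) x)) =
      zetaRoot m ^ (k - l) *
        (fourierWave lam m k x * (starRingEnd ℂ) (fourierWave lam m l x)) := by
    intro x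
    rw [fourierWave_rotate lam m k (hz x), fourierWave_rotate lam m l (hz x), map_mul, map_zpow₀,
      conj_zetaRoot, inv_zpow, zpow_sub₀ (zetaRoot_ne_zero m)]
    ring
  simp only [hval] at hrot
  rw [integral_const_mul] at hrot
  have hne : zetaRoot m ^ (k - l) ≠ 1 := by
    intro h
    have hd := ((zetaRoot_isPrimitiveRoot m).zpow_eq_one_iff_dvd _).1 h
    have : k - l = 0 := by
      refine Int.eq_zero_of_abs_lt_dvd hd ?_
      rw [Finset.mem_Icc] at hk hl
      rw [abs_lt]
      constructor <;> push_cast <;> omega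
    omega
  have h2 : (zetaRoot m ^ (k - l) - 1) *
      ∫ x, fourierWave lam m k x * (starRingEnd ℂ) (fourierWave lam m l x) ∂(samplingMeasure α)
      = 0 := by
    rw [sub_mul, one_mul, hrot, sub_self]
  exact (mul_eq_zero.1 h2).resolve_left (sub_ne_zero.2 hne)

theorem integral_fourierWave_mul_conj_self (lam α : ℝ) (m : ℕ) (k : ℤ) :
    ∫ x, fourierWave lam m k x * (starRingEnd ℂ) (fourierWave lam m k x) ∂(samplingMeasure α)
      = (fourierNormSq lam α m k : ℂ) := by
  simp only [Complex.mul_conj, Complex.normSq_eq_norm_sq]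
  exact integral_ofReal

/-- As long as part of the measure lives on the disc, the norms of the Fourier coefficients are
bounded below independently of `m`: near the origin the leading monomial is at least twice the
error term. -/
theorem exists_le_fourierNormSq_of_lt_one {lam : ℝ} (hlam : 0 < lam) {α : ℝ} (h0 : 0 ≤ α)
    (h1 : α < 1) (n : ℕ) :
    ∃ δ : ℝ, 0 < δ ∧ ∀ (m : ℕ) (k : ℤ), k.natAbs = n → n ≤ m → δ ≤ fourierNormSq lam α m k := by
  -- The radius below which the relative error `r * lam * exp lam` is at most `1 / 2`.
  set r : ℝ := 1 / (2 * (lam * Real.exp lam) + 1) with hr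
  have hr0 : 0 < r := by positivity
  have hr1 : r ≤ 1 := by
    rw [hr, div_le_one (by positivity)]
    have : 0 ≤ 2 * (lam * Real.exp lam) := by positivity
    linarith
  have hrC : r * (lam * Real.exp lam) ≤ 1 / 2 := by
    rw [hr, div_mul_eq_mul_div, div_le_iff₀ (by positivity)]
    linarith
  -- The ball `B` lies in the annulus of radii `r / 2` and `r`, where the leading monomial is
  -- bounded away from zero.
  set x₀ : Plane := (3 * r / 4) • circlePoint 0 with hx₀
  have hnx₀ : ‖x₀‖ = 3 * r / 4 := by
    rw [hx₀, norm_smul, norm_circlePoint, mul_one, Real.norm_of_nonneg (by positivity)]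
  set B : Set Plane := Metric.ball x₀ (r / 4) with hB
  have hBnorm : ∀ x ∈ B, r / 2 ≤ ‖x‖ ∧ ‖x‖ ≤ r := by
    intro x hx
    rw [hB, mem_ball_iff_norm] at hx
    have h2 := abs_norm_sub_norm_le x x₀
    rw [hnx₀, abs_le] at h2
    constructor <;> linarith [h2.1, h2.2]
  have hBsub : B ⊆ unitDisc := fun x hx => mem_unitDisc.2 ((hBnorm x hx).2.trans hr1)
  have hBfin : volume B ≠ ⊤ := Metric.isBounded_ball.measure_lt_top.ne
  have hBpos : 0 < volume.real B :=
    ENNReal.toReal_pos (Metric.measure_ball_pos volume x₀ (by positivity)).ne' hBfin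
  have hlead : 0 < leadTerm lam n (r / 2) := leadTerm_pos hlam n (by positivity)
  have hv := volume_real_unitDisc_pos
  refine ⟨(1 - α) * (volume.real unitDisc)⁻¹ *
    (volume.real B * (leadTerm lam n (r / 2) / 2) ^ 2), ?_, ?_⟩
  · have : 0 < 1 - α := by linarith
    positivity
  · intro m k hk hnm
    have hcont := continuous_fourierWave_normSq lam m k
    refine le_trans ?_ (disc_integral_le_integral_samplingMeasure h0 h1.le hcont
      (fun x => by positivity))
    refine mul_le_mul_of_nonneg_left ?_
      (mul_nonneg (by linarith) (inv_nonneg.2 hv.le))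
    have hpt : ∀ x ∈ B, (leadTerm lam n (r / 2) / 2) ^ 2 ≤ ‖fourierWave lam m k x‖ ^ 2 := by
      intro x hx
      obtain ⟨hx1, hx2⟩ := hBnorm x hx
      have hE := abs_norm_fourierWave_sub_leadTerm_le hlam m k (hk ▸ hnm) (hx2.trans hr1)
      rw [hk] at hE
      have hle : leadTerm lam n (r / 2) ≤ leadTerm lam n ‖x‖ := by
        unfold leadTerm
        gcongr
      have herr : ‖x‖ * (lam * Real.exp lam) / (n + 1) ≤ 1 / 2 := by
        refine (div_le_self (by positivity) ?_).trans (le_trans ?_ hrC)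
        · have : (0 : ℝ) ≤ n := Nat.cast_nonneg n
          linarith
        · gcongr
      have hle2 := mul_le_mul_of_nonneg_left herr (leadTerm_nonneg hlam n (norm_nonneg x))
      have := (abs_le.1 hE).1
      refine pow_le_pow_left₀ (by positivity) ?_ 2
      linarith
    calc volume.real B * (leadTerm lam n (r / 2) / 2) ^ 2
        = ∫ _ in B, (leadTerm lam n (r / 2) / 2) ^ 2 := by
          rw [setIntegral_const, smul_eq_mul]
      _ ≤ ∫ x in B, ‖fourierWave lam m k x‖ ^ 2 := by
          refine setIntegral_mono_on (integrableOn_const hBfin)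
            (hcont.integrable_restrict_unitDisc.mono_measure
              (Measure.restrict_mono hBsub le_rfl)) measurableSet_ball hpt
      _ ≤ ∫ x in unitDisc, ‖fourierWave lam m k x‖ ^ 2 :=
          setIntegral_mono_set hcont.integrable_restrict_unitDisc
            (Filter.Eventually.of_forall fun x => by positivity)
            (Filter.Eventually.of_forall hBsub)

/-! ### Bessel functions as Fourier coefficients -/

/-- The integrand of the Fourier coefficients of `t ↦ exp (i lam cos t)`. -/
def waveIntegrand (lam : ℝ) (k : ℤ) (t : ℝ) : ℂ :=
  Complex.exp (((lam * Real.cos t - k * t : ℝ) : ℂ) * Complex.I)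

theorem continuous_waveIntegrand (lam : ℝ) (k : ℤ) : Continuous (waveIntegrand lam k) := by
  unfold waveIntegrand
  fun_prop

theorem waveIntegrand_periodic (lam : ℝ) (k : ℤ) :
    Function.Periodic (waveIntegrand lam k) (2 * Real.pi) := by
  intro t
  rw [waveIntegrand, waveIntegrand, Complex.exp_eq_exp_iff_exists_int]
  refine ⟨-k, ?_⟩
  rw [Real.cos_add_two_pi]
  push_cast
  ring

theorem integral_waveIntegrand_neg (lam : ℝ) (k : ℤ) :
    ∫ t in -Real.pi..Real.pi, waveIntegrand lam (-k) t =
      ∫ t in -Real.pi..Real.pi, waveIntegrand lam k t := by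
  have := intervalIntegral.integral_comp_neg (a := -Real.pi) (b := Real.pi) (waveIntegrand lam k)
  rw [neg_neg] at this
  rw [← this]
  congr 1
  funext t
  simp [waveIntegrand]

theorem norm_integral_waveIntegrand_natCast (lam : ℝ) (n : ℕ) :
    ‖∫ t in -Real.pi..Real.pi, waveIntegrand lam n t‖ = 2 * Real.pi * |besselJ n lam| := by
  have hpi := Real.pi_pos
  set g : ℝ → ℂ := fun t => Complex.exp (((lam * Real.sin t - n * t : ℝ) : ℂ) * Complex.I) with hg
  have hgc : Continuous g := by
    rw [hg]
    fun_prop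
  -- A shift by a quarter period turns the cosine into the sine of Bessel's integral.
  have hshift : ∀ t, waveIntegrand lam n (t - Real.pi / 2) =
      Complex.exp ((n * Real.pi / 2 : ℝ) * Complex.I) * g t := by
    intro t
    rw [hg, waveIntegrand, ← Complex.exp_add, Real.cos_sub_pi_div_two]
    congr 1
    push_cast
    ring
  have hper := (waveIntegrand_periodic lam n).intervalIntegral_add_eq (-Real.pi - Real.pi / 2)
    (-Real.pi)
  rw [show -Real.pi + 2 * Real.pi = Real.pi by ring,
    show -Real.pi - Real.pi / 2 + 2 * Real.pi = Real.pi - Real.pi / 2 by ring,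
    ← intervalIntegral.integral_comp_sub_right] at hper
  simp only [hshift] at hper
  rw [← hper, intervalIntegral.integral_const_mul, norm_mul, Complex.norm_exp_ofReal_mul_I, one_mul,
    ← intervalIntegral.integral_add_adjacent_intervals (hgc.intervalIntegrable (-Real.pi) 0)
      (hgc.intervalIntegrable 0 Real.pi)]
  have hneg := intervalIntegral.integral_comp_neg (a := 0) (b := Real.pi) g
  rw [neg_zero] at hneg
  have hgn : Continuous fun t => g (-t) := hgc.comp continuous_neg
  rw [← hneg, ← intervalIntegral.integral_add
    (hgn.intervalIntegrable 0 Real.pi) (hgc.intervalIntegrable 0 Real.pi)]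
  have hsum : ∀ t, g (-t) + g t = ((2 * Real.cos (n * t - lam * Real.sin t) : ℝ) : ℂ) := by
    intro t
    simp only [hg, Real.sin_neg]
    push_cast
    rw [Complex.two_cos]
    congr 2 <;> ring
  simp only [hsum]
  rw [intervalIntegral.integral_ofReal, Complex.norm_real, intervalIntegral.integral_const_mul,
    besselJ, Real.norm_eq_abs, abs_mul, abs_mul, abs_of_pos two_pos,
    abs_of_pos (one_div_pos.2 hpi)]
  field_simp

theorem norm_integral_waveIntegrand (lam : ℝ) (k : ℤ) :
    ‖∫ t in -Real.pi..Real.pi, waveIntegrand lam k t‖ =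
      2 * Real.pi * |besselJ k.natAbs lam| := by
  rw [← norm_integral_waveIntegrand_natCast]
  rcases Int.natAbs_eq k with h | h
  · rw [← h]
  · conv_lhs => rw [h]
    rw [integral_waveIntegrand_neg]

/-- On the unit circle, the `k`-th angular Fourier coefficient of `fourierWave lam m k` is that of
a single plane wave. -/
theorem integral_fourierWave_circlePoint (lam : ℝ) (m : ℕ) (k : ℤ) :
    ∫ t in -Real.pi..Real.pi, fourierWave lam m k (circlePoint t) *
        Complex.exp (((-k * t : ℝ) : ℂ) * Complex.I) =
      ∫ t in -Real.pi..Real.pi, waveIntegrand lam k t := by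
  have hN : ((2 * m + 1 : ℕ) : ℂ) ≠ 0 := Nat.cast_ne_zero.2 (by omega)
  have hpt : ∀ t, fourierWave lam m k (circlePoint t) *
      Complex.exp (((-k * t : ℝ) : ℂ) * Complex.I) = ((2 * m + 1 : ℕ) : ℂ)⁻¹ *
        ∑ j ∈ Finset.Icc (-(m : ℤ)) m,
          waveIntegrand lam k (t - 2 * j * Real.pi / (2 * m + 1)) := by
    intro t
    rw [fourierWave, mul_assoc, Finset.sum_mul]
    congr 1
    refine Finset.sum_congr rfl fun j _ => ?_
    rw [zpow_mul, zetaRoot_zpow, planeWave, waveIntegrand, ← Complex.exp_int_mul, ← Complex.exp_add,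
      ← Complex.exp_add]
    congr 1
    set θ : ℝ := 2 * j * Real.pi / (2 * m + 1) with hθ
    have hin : inner ℝ (waveVector lam m j) (circlePoint t) = lam * Real.cos (t - θ) := by
      rw [Real.cos_sub]
      simp only [waveVector, circlePoint, PiLp.inner_apply, Fin.sum_univ_two, ← hθ]
      simp
      ring
    rw [hin]
    push_cast
    ring
  simp only [hpt]
  rw [intervalIntegral.integral_const_mul, intervalIntegral.integral_finsetSum]
  · have hj : ∀ j : ℤ, ∫ t in -Real.pi..Real.pi,
        waveIntegrand lam k (t - 2 * j * Real.pi / (2 * m + 1)) =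
        ∫ t in -Real.pi..Real.pi, waveIntegrand lam k t := by
      intro j
      rw [intervalIntegral.integral_comp_sub_right]
      have := (waveIntegrand_periodic lam k).intervalIntegral_add_eq
        (-Real.pi - 2 * j * Real.pi / (2 * m + 1)) (-Real.pi)
      rw [show -Real.pi + 2 * Real.pi = Real.pi by ring,
        show -Real.pi - 2 * j * Real.pi / (2 * m + 1) + 2 * Real.pi =
          Real.pi - 2 * j * Real.pi / (2 * m + 1) by ring] at this
      exact this
    simp only [hj, Finset.sum_const, nsmul_eq_mul, Int.card_Icc]
    rw [show ((m : ℤ) + 1 - -(m : ℤ)).toNat = 2 * m + 1 by omega, inv_mul_cancel_left₀ hN]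
  · intro j _
    exact ((continuous_waveIntegrand lam k).comp
      (continuous_id.sub continuous_const)).intervalIntegrable _ _

/-- Parseval's inequality for one angular frequency, on the unit circle. -/
theorem mul_besselJ_sq_le_fourierNormSq {α : ℝ} (h0 : 0 ≤ α) (h1 : α ≤ 1) (lam : ℝ) (m : ℕ)
    (k : ℤ) : α * besselJ k.natAbs lam ^ 2 ≤ fourierNormSq lam α m k := by
  have hpi := Real.pi_pos
  set c : ℝ := |besselJ k.natAbs lam| with hc
  have hcont : Continuous fun t => ‖fourierWave lam m k (circlePoint t)‖ :=
    ((continuous_fourierWave lam m k).comp continuous_circlePoint).norm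
  have hL1 : 2 * Real.pi * c ≤ ∫ t in -Real.pi..Real.pi, ‖fourierWave lam m k (circlePoint t)‖ := by
    rw [hc, ← norm_integral_waveIntegrand, ← integral_fourierWave_circlePoint lam m k]
    refine (intervalIntegral.norm_integral_le_integral_norm (by linarith)).trans_eq ?_
    congr 1
    funext t
    rw [norm_mul, Complex.norm_exp_ofReal_mul_I, mul_one]
  -- Integrating `(‖f‖ - c) ^ 2 ≥ 0` replaces the Cauchy-Schwarz inequality.
  have hL2 : ∫ t in -Real.pi..Real.pi, (2 * c * ‖fourierWave lam m k (circlePoint t)‖ - c ^ 2) ≤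
      ∫ t in -Real.pi..Real.pi, ‖fourierWave lam m k (circlePoint t)‖ ^ 2 := by
    refine intervalIntegral.integral_mono_on (by linarith) ?_ ?_ fun t _ => ?_
    · exact ((hcont.const_mul (2 * c)).sub continuous_const).intervalIntegrable _ _
    · exact (hcont.pow 2).intervalIntegrable _ _
    · nlinarith [sq_nonneg (‖fourierWave lam m k (circlePoint t)‖ - c)]
  rw [intervalIntegral.integral_sub ((hcont.const_mul (2 * c)).intervalIntegrable _ _)
    (continuous_const.intervalIntegrable _ _), intervalIntegral.integral_const_mul,
    intervalIntegral.integral_const, smul_eq_mul] at hL2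
  refine le_trans ?_ (circle_integral_le_integral_samplingMeasure h0 h1
    (continuous_fourierWave_normSq lam m k) (fun x => by positivity))
  rw [mul_assoc, ← sq_abs, ← hc]
  refine mul_le_mul_of_nonneg_left ?_ h0
  rw [le_inv_mul_iff₀ Real.two_pi_pos]
  have hc0 : 0 ≤ c := abs_nonneg _
  have := mul_le_mul_of_nonneg_left hL1 (mul_nonneg zero_le_two hc0)
  linarith

/-- A lower bound for the norms of the Fourier coefficients that is uniform in `m`. -/
theorem exists_le_fourierNormSq {lam : ℝ} (hlam : 0 < lam) {α : ℝ} (h0 : 0 ≤ α) (h1 : α ≤ 1)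
    (hJ : α = 1 → ∀ n : ℕ, besselJ n lam ≠ 0) :
    ∃ δ : ℕ → ℝ, (∀ n, 0 < δ n) ∧
      ∀ (m : ℕ) (k : ℤ), k ∈ Finset.Icc (-(m : ℤ)) m →
        δ k.natAbs ≤ fourierNormSq lam α m k := by
  rcases h1.lt_or_eq with h | h
  · choose δ hδ hle using exists_le_fourierNormSq_of_lt_one hlam h0 h
    refine ⟨δ, hδ, fun m k hk => hle _ m k rfl ?_⟩
    rw [Finset.mem_Icc] at hk
    omega
  · refine ⟨fun n => α * besselJ n lam ^ 2, fun n => ?_, fun m k _ =>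
      mul_besselJ_sq_le_fourierNormSq h0 h1 lam m k⟩
    have := hJ h n
    rw [h]
    positivity

/-- For the uniform measure, an upper bound for the norms of the Fourier coefficients. -/
theorem fourierNormSq_zero_le {lam : ℝ} (hlam : 0 < lam) (m : ℕ) (k : ℤ) (hk : k.natAbs ≤ m) :
    fourierNormSq lam 0 m k ≤ (leadTerm lam k.natAbs 1 *
      (1 + lam * Real.exp lam / (k.natAbs + 1))) ^ 2 / (k.natAbs + 1) := by
  have hcont := continuous_fourierWave_normSq lam m k
  set A : ℝ := (leadTerm lam k.natAbs 1 * (1 + lam * Real.exp lam / (k.natAbs + 1))) ^ 2 with hA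
  rw [fourierNormSq, integral_samplingMeasure le_rfl zero_le_one hcont]
  rw [sub_zero, one_mul, zero_mul, zero_smul, add_zero, smul_eq_mul]
  have hle : ∫ x in unitDisc, ‖fourierWave lam m k x‖ ^ 2 ≤
      ∫ x in unitDisc, A * ‖x‖ ^ (2 * k.natAbs) := by
    have hc2 : Continuous fun x : Plane => A * ‖x‖ ^ (2 * k.natAbs) :=
      continuous_const.mul (continuous_norm.pow _)
    refine setIntegral_mono_on hcont.integrable_restrict_unitDisc
      hc2.integrable_restrict_unitDisc Metric.isClosed_closedBall.measurableSet fun x hx => ?_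
    have hx1 := mem_unitDisc.1 hx
    have hE := (abs_le.1 (abs_norm_fourierWave_sub_leadTerm_le hlam m k hk hx1)).2
    rw [hA, mul_comm 2, pow_mul, ← mul_pow]
    refine pow_le_pow_left₀ (norm_nonneg _) ?_ 2
    have hlt := leadTerm_nonneg hlam k.natAbs (norm_nonneg x)
    calc ‖fourierWave lam m k x‖ ≤ leadTerm lam k.natAbs ‖x‖ *
          (1 + ‖x‖ * (lam * Real.exp lam) / (k.natAbs + 1)) := by linarith
      _ ≤ leadTerm lam k.natAbs ‖x‖ * (1 + 1 * (lam * Real.exp lam) / (k.natAbs + 1)) := by gcongr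
      _ = _ := by rw [leadTerm_eq lam k.natAbs ‖x‖]; ring
  rw [integral_const_mul, integral_unitDisc_norm_pow] at hle
  have hv := volume_real_unitDisc_pos
  calc (volume.real unitDisc)⁻¹ * ∫ x in unitDisc, ‖fourierWave lam m k x‖ ^ 2
      ≤ (volume.real unitDisc)⁻¹ * (A * (volume.real unitDisc / (k.natAbs + 1))) := by gcongr
    _ = A / (k.natAbs + 1) := by field_simp

/-! ### The kernel and its maximum -/

section Kernel

variable {V : Submodule ℂ (Plane → ℂ)} {ν : Measure Plane} {n n' : ℕ}
  {L : Fin n → Plane → ℂ} {M : Fin n' → Plane → ℂ}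

theorem IsONBasis.eq_sum (hL : IsONBasis V ν L) {f : Plane → ℂ} (hf : f ∈ V) (x : Plane) :
    f x = ∑ j, (∫ y, f y * (starRingEnd ℂ) (L j y) ∂ν) * L j x := by
  obtain ⟨hspan, hmem, hon⟩ := hL
  rw [← hspan, Submodule.mem_span_range_iff_exists_fun] at hf
  obtain ⟨c, rfl⟩ := hf
  have hcoef : ∀ j, ∫ y, (∑ i, c i • L i) y * (starRingEnd ℂ) (L j y) ∂ν = c j := by
    intro j
    have hpt : ∀ y, (∑ i, c i • L i) y * (starRingEnd ℂ) (L j y) =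
        ∑ i, c i * (L i y * (starRingEnd ℂ) (L j y)) := by
      intro y
      rw [Finset.sum_apply, Finset.sum_mul]
      exact Finset.sum_congr rfl fun i _ => by rw [Pi.smul_apply, smul_eq_mul, mul_assoc]
    have hint : ∀ i, Integrable (fun y => L i y * (starRingEnd ℂ) (L j y)) ν := fun i =>
      (hmem i).integrable_mul (hmem j).star
    simp only [hpt]
    rw [integral_finsetSum _ fun i _ => (hint i).const_mul (c i)]
    simp only [integral_const_mul, hon]
    simp
  simp only [hcoef]
  simp [Finset.sum_apply]

/-- The diagonal of the reproducing kernel does not depend on the orthonormal basis. -/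
theorem IsONBasis.sum_norm_sq_eq (hL : IsONBasis V ν L) (hM : IsONBasis V ν M) (x : Plane) :
    ∑ j, ‖L j x‖ ^ 2 = ∑ i, ‖M i x‖ ^ 2 := by
  have hLV : ∀ j, L j ∈ V := fun j => hL.1 ▸ Submodule.subset_span ⟨j, rfl⟩
  have hMV : ∀ i, M i ∈ V := fun i => hM.1 ▸ Submodule.subset_span ⟨i, rfl⟩
  have hconj : ∀ i j, (starRingEnd ℂ) (∫ y, M i y * (starRingEnd ℂ) (L j y) ∂ν) =
      ∫ y, L j y * (starRingEnd ℂ) (M i y) ∂ν := by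
    intro i j
    rw [← integral_conj]
    congr 1
    funext y
    rw [map_mul, Complex.conj_conj, mul_comm]
  have key : ∑ j, L j x * (starRingEnd ℂ) (L j x) = ∑ i, M i x * (starRingEnd ℂ) (M i x) := by
    have h1 : ∀ j, L j x * (starRingEnd ℂ) (L j x) =
        ∑ i, (∫ y, L j y * (starRingEnd ℂ) (M i y) ∂ν) * M i x * (starRingEnd ℂ) (L j x) := by
      intro j
      rw [← Finset.sum_mul, ← hM.eq_sum (hLV j) x]
    have h2 : ∀ i, M i x * (starRingEnd ℂ) (M i x) =
        ∑ j, (∫ y, L j y * (starRingEnd ℂ) (M i y) ∂ν) * M i x * (starRingEnd ℂ) (L j x) := by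
      intro i
      have hM' : (starRingEnd ℂ) (M i x) =
          ∑ j, (∫ y, L j y * (starRingEnd ℂ) (M i y) ∂ν) * (starRingEnd ℂ) (L j x) := by
        rw [hL.eq_sum (hMV i) x, map_sum]
        exact Finset.sum_congr rfl fun j _ => by rw [map_mul, hconj]
      rw [hM', Finset.mul_sum]
      exact Finset.sum_congr rfl fun j _ => by ring
    simp only [h1, h2]
    exact Finset.sum_comm
  simp only [Complex.mul_conj, Complex.normSq_eq_norm_sq] at key
  exact_mod_cast key

end Kernel

theorem sum_Icc_eq_sum_fin {A : Type*} [AddCommMonoid A] (m : ℕ) (F : ℤ → A) :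
    ∑ j ∈ Finset.Icc (-(m : ℤ)) m, F j = ∑ i : Fin (2 * m + 1), F ((i : ℤ) - m) := by
  rw [sum_Icc_eq_sum_range, Finset.sum_range]

/-- The normalized Fourier coefficients are an orthonormal basis. -/
theorem isONBasis_fourierWave {α : ℝ} (h0 : 0 ≤ α) (h1 : α ≤ 1) (lam : ℝ) (m : ℕ)
    (hpos : ∀ k ∈ Finset.Icc (-(m : ℤ)) m, 0 < fourierNormSq lam α m k) :
    IsONBasis (planeWaveSpace lam m) (samplingMeasure α)
      (fun (i : Fin (2 * m + 1)) x =>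
        ((Real.sqrt (fourierNormSq lam α m ((i : ℤ) - m)))⁻¹ : ℂ) *
          fourierWave lam m ((i : ℤ) - m) x) := by
  have hmem : ∀ i : Fin (2 * m + 1), ((i : ℤ) - m) ∈ Finset.Icc (-(m : ℤ)) m := by
    intro i
    have := i.2
    rw [Finset.mem_Icc]
    omega
  have hsq : ∀ i : Fin (2 * m + 1),
      (Real.sqrt (fourierNormSq lam α m ((i : ℤ) - m)) : ℂ) ≠ 0 := fun i =>
    Complex.ofReal_ne_zero.2 (Real.sqrt_pos.2 (hpos _ (hmem i))).ne'
  have hL2 : ∀ k : ℤ, MemLp (fourierWave lam m k) 2 (samplingMeasure α) := fun k =>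
    MemLp.of_bound (continuous_fourierWave lam m k).aestronglyMeasurable 1
      (Filter.Eventually.of_forall (norm_fourierWave_le_one lam m k))
  refine ⟨?_, fun i => (hL2 _).const_mul _, fun i j => ?_⟩
  · rw [← span_fourierWave]
    apply le_antisymm
    · rw [Submodule.span_le]
      rintro _ ⟨i, rfl⟩
      exact Submodule.smul_mem _ _ (Submodule.subset_span ⟨_, Finset.mem_Icc.1 (hmem i), rfl⟩)
    · rw [Submodule.span_le]
      rintro _ ⟨k, hk, rfl⟩
      rw [Set.mem_Icc] at hk
      obtain ⟨i, hi⟩ : ∃ i : Fin (2 * m + 1), (i : ℤ) - m = k :=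
        ⟨⟨(k + m).toNat, by omega⟩, by simp only; omega⟩
      have hk' : fourierWave lam m k = (Real.sqrt (fourierNormSq lam α m ((i : ℤ) - m)) : ℂ) •
          fun x => ((Real.sqrt (fourierNormSq lam α m ((i : ℤ) - m)))⁻¹ : ℂ) *
            fourierWave lam m ((i : ℤ) - m) x := by
        funext x
        rw [Pi.smul_apply, smul_eq_mul, mul_inv_cancel_left₀ (hsq i), hi]
      rw [SetLike.mem_coe, hk']
      exact Submodule.smul_mem _ _ (Submodule.subset_span ⟨i, rfl⟩)
  · have hpt : ∀ x, ((Real.sqrt (fourierNormSq lam α m ((i : ℤ) - m)))⁻¹ : ℂ) *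
          fourierWave lam m ((i : ℤ) - m) x *
        (starRingEnd ℂ) (((Real.sqrt (fourierNormSq lam α m ((j : ℤ) - m)))⁻¹ : ℂ) *
          fourierWave lam m ((j : ℤ) - m) x) =
        ((Real.sqrt (fourierNormSq lam α m ((i : ℤ) - m)))⁻¹ : ℂ) *
          ((Real.sqrt (fourierNormSq lam α m ((j : ℤ) - m)))⁻¹ : ℂ) *
          (fourierWave lam m ((i : ℤ) - m) x *
            (starRingEnd ℂ) (fourierWave lam m ((j : ℤ) - m) x)) := by
      intro x
      rw [map_mul, map_inv₀, Complex.conj_ofReal]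
      ring
    simp only [hpt]
    rw [integral_const_mul]
    split_ifs with hij
    · subst hij
      rw [integral_fourierWave_mul_conj_self]
      have hs := Real.mul_self_sqrt (hpos _ (hmem i)).le
      have hs' := congrArg (fun r : ℝ => (r : ℂ)) hs
      simp only [Complex.ofReal_mul] at hs'
      have := hsq i
      rw [← hs']
      field_simp
    · rw [integral_fourierWave_mul_conj h0 h1 lam m (hmem i) (hmem j), mul_zero]
      intro h
      apply hij
      ext
      omega

/-- The diagonal of the reproducing kernel of the plane wave space, in the basis of Fourier
coefficients. -/
def waveKernel (lam α : ℝ) (m : ℕ) (x : Plane) : ℝ :=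
  ∑ k ∈ Finset.Icc (-(m : ℤ)) m, ‖fourierWave lam m k x‖ ^ 2 / fourierNormSq lam α m k

theorem continuous_waveKernel (lam α : ℝ) (m : ℕ) : Continuous (waveKernel lam α m) := by
  unfold waveKernel
  exact continuous_finsetSum _ fun k _ => (continuous_fourierWave_normSq lam m k).div_const _

/-- The maximum of `IsKernelMax` exists, and may be computed in the basis of Fourier
coefficients. -/
theorem exists_isKernelMax {α : ℝ} (h0 : 0 ≤ α) (h1 : α ≤ 1) (lam : ℝ) (m : ℕ)
    (hpos : ∀ k ∈ Finset.Icc (-(m : ℤ)) m, 0 < fourierNormSq lam α m k) :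
    ∃ K : ℝ, IsKernelMax (planeWaveSpace lam m) (samplingMeasure α) K ∧
      IsGreatest (waveKernel lam α m '' unitDisc) K := by
  obtain ⟨x₀, hx₀, hmax⟩ := (isCompact_closedBall (0 : Plane) 1).exists_isMaxOn
    ⟨0, Metric.mem_closedBall_self zero_le_one⟩ (continuous_waveKernel lam α m).continuousOn
  have hgr : IsGreatest (waveKernel lam α m '' unitDisc) (waveKernel lam α m x₀) := by
    refine ⟨⟨x₀, hx₀, rfl⟩, ?_⟩
    rintro _ ⟨x, hx, rfl⟩
    exact hmax hx
  have hB := isONBasis_fourierWave h0 h1 lam m hpos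
  refine ⟨_, ⟨⟨_, _, hB⟩, fun n L hL => ?_⟩, hgr⟩
  have : (fun x : Plane => ∑ j, ‖L j x‖ ^ 2) = waveKernel lam α m := by
    funext x
    rw [hL.sum_norm_sq_eq hB x, waveKernel, sum_Icc_eq_sum_fin]
    refine Finset.sum_congr rfl fun i _ => ?_
    have hi := i.2
    have hp := hpos ((i : ℤ) - m) (by rw [Finset.mem_Icc]; omega)
    rw [norm_mul, norm_inv, Complex.norm_real, Real.norm_of_nonneg (Real.sqrt_nonneg _), mul_pow,
      inv_pow, Real.sq_sqrt hp.le]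
    ring
  rw [this]
  exact hgr

/-! ### Bounds for the maximum -/

theorem exists_nat_div_le {C ε : ℝ} (hε : 0 < ε) :
    ∃ n₀ : ℕ, ∀ n : ℕ, n₀ ≤ n → C / (n + 1) ≤ ε := by
  obtain ⟨n₁, hn₁⟩ := exists_nat_ge (C / ε)
  refine ⟨n₁, fun n hn => ?_⟩
  have h1 : (n₁ : ℝ) ≤ n := by exact_mod_cast hn
  rw [div_le_iff₀ hε] at hn₁
  rw [div_le_iff₀ (by positivity)]
  nlinarith

theorem exists_one_add_sq_le {C : ℝ} (hC : 1 < C) :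
    ∃ ε : ℝ, 0 < ε ∧ ε < 1 ∧ (1 + ε) ^ 2 ≤ C * (1 - ε) ^ 2 := by
  refine ⟨(C - 1) / (4 * C), by apply div_pos <;> linarith, ?_, ?_⟩
  · rw [div_lt_one (by linarith)]
    linarith
  · set ε := (C - 1) / (4 * C) with hε
    have h1 : 4 * (C * ε) = C - 1 := by
      rw [hε]
      field_simp
    have h0 : 0 < ε := by
      rw [hε]
      apply div_pos <;> linarith
    nlinarith [mul_pos h0 h0]

theorem sum_Icc_natAbs (m : ℕ) :
    ∑ k ∈ Finset.Icc (-(m : ℤ)) m, (k.natAbs : ℝ) = m * (m + 1) := by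
  induction m with
  | zero => simp
  | succ m ih =>
    have : Finset.Icc (-((m + 1 : ℕ) : ℤ)) ((m + 1 : ℕ) : ℤ) =
        insert (-((m + 1 : ℕ) : ℤ)) (insert ((m + 1 : ℕ) : ℤ) (Finset.Icc (-(m : ℤ)) m)) := by
      ext k
      simp only [Finset.mem_insert, Finset.mem_Icc]
      omega
    rw [this, Finset.sum_insert, Finset.sum_insert, ih, Int.natAbs_neg, Int.natAbs_natCast]
    · push_cast
      ring
    · simp only [Finset.mem_Icc]
      omega
    · simp only [Finset.mem_insert, Finset.mem_Icc]
      omega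

/-- For the uniform measure the kernel on the boundary grows quadratically: each frequency `k`
contributes about `|k| + 1`. -/
theorem exists_le_waveKernel_zero {lam : ℝ} (hlam : 0 < lam) :
    ∃ c₀ : ℝ, ∀ m : ℕ, c₀ + (m : ℝ) ^ 2 / 4 ≤ waveKernel lam 0 m (circlePoint 0) := by
  obtain ⟨n₀, hn₀⟩ := exists_nat_div_le (C := lam * Real.exp lam) (ε := 1 / 10) (by norm_num)
  obtain ⟨δ, hδ, hle⟩ := exists_le_fourierNormSq hlam le_rfl zero_le_one
    (fun h => absurd h zero_ne_one)
  refine ⟨-(n₀ : ℝ) ^ 2 - n₀, fun m => ?_⟩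
  -- For `|k| ≥ n₀` the relative error is at most `1 / 10`, and `(9 / 10) ^ 2 ≥ (11 / 10) ^ 2 / 2`
  -- leaves at least half of `|k| + 1`; for `|k| < n₀` the bound is negative.
  have hterm : ∀ k ∈ Finset.Icc (-(m : ℤ)) m, ((k.natAbs : ℝ) - n₀) / 2 ≤
      ‖fourierWave lam m k (circlePoint 0)‖ ^ 2 / fourierNormSq lam 0 m k := by
    intro k hk
    have hnpos : 0 < fourierNormSq lam 0 m k := (hδ _).trans_le (hle m k hk)
    have hkm : k.natAbs ≤ m := by rw [Finset.mem_Icc] at hk; omega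
    rcases lt_or_ge k.natAbs n₀ with hlt | hge
    · have : (k.natAbs : ℝ) ≤ n₀ := by exact_mod_cast hlt.le
      exact le_trans (by linarith) (div_nonneg (sq_nonneg _) hnpos.le)
    · have hε := hn₀ _ hge
      have hup := fourierNormSq_zero_le hlam m k hkm
      have hE := (abs_le.1 (abs_norm_fourierWave_sub_leadTerm_le hlam m k hkm
        (norm_circlePoint 0).le)).1
      rw [norm_circlePoint, one_mul] at hE
      have hA := leadTerm_pos hlam k.natAbs one_pos
      set A := leadTerm lam k.natAbs 1
      set ε := lam * Real.exp lam / ((k.natAbs : ℝ) + 1) with hεdef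
      have hε0 : 0 ≤ ε := by positivity
      have hlow : A * (9 / 10) ≤ ‖fourierWave lam m k (circlePoint 0)‖ := by nlinarith
      have hsq : (A * (9 / 10)) ^ 2 ≤ ‖fourierWave lam m k (circlePoint 0)‖ ^ 2 :=
        pow_le_pow_left₀ (by positivity) hlow 2
      have hup2 : fourierNormSq lam 0 m k ≤ (A * (11 / 10)) ^ 2 / (k.natAbs + 1) := by
        refine hup.trans ?_
        gcongr
        linarith
      rw [le_div_iff₀ hnpos]
      have hk1 : (0 : ℝ) < k.natAbs + 1 := by positivity
      calc ((k.natAbs : ℝ) - n₀) / 2 * fourierNormSq lam 0 m k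
          ≤ ((k.natAbs : ℝ) + 1) / 2 * fourierNormSq lam 0 m k := by
            have : (0 : ℝ) ≤ n₀ := Nat.cast_nonneg _
            gcongr
            linarith
        _ ≤ ((k.natAbs : ℝ) + 1) / 2 * ((A * (11 / 10)) ^ 2 / (k.natAbs + 1)) := by gcongr
        _ = (A * (11 / 10)) ^ 2 / 2 := by field_simp
        _ ≤ (A * (9 / 10)) ^ 2 := by nlinarith [sq_nonneg A]
        _ ≤ _ := hsq
  have hsum := Finset.sum_le_sum hterm
  rw [← Finset.sum_div, Finset.sum_sub_distrib, sum_Icc_natAbs, Finset.sum_const, Int.card_Icc,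
    show ((m : ℤ) + 1 - -(m : ℤ)).toNat = 2 * m + 1 by omega, nsmul_eq_mul] at hsum
  refine le_trans ?_ hsum
  push_cast
  have : (0 : ℝ) ≤ m := Nat.cast_nonneg _
  have : (0 : ℝ) ≤ n₀ := Nat.cast_nonneg _
  nlinarith [sq_nonneg ((m : ℝ) / 2 - n₀)]

/-- If the measure charges the circle, every large frequency contributes at most about `1 / α`,
and the remaining ones contribute a bounded amount. -/
theorem exists_waveKernel_le {lam : ℝ} (hlam : 0 < lam) {α : ℝ} (h0 : 0 < α) (h1 : α ≤ 1)
    {δ : ℕ → ℝ} (hδ : ∀ n, 0 < δ n)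
    (hle : ∀ (m : ℕ) (k : ℤ), k ∈ Finset.Icc (-(m : ℤ)) m →
      δ k.natAbs ≤ fourierNormSq lam α m k) {C₂ : ℝ} (hC₂ : 1 < C₂) :
    ∃ C₁ : ℝ, ∀ (m : ℕ) (x : Plane), x ∈ unitDisc →
      waveKernel lam α m x ≤ C₁ + C₂ * (2 * (m : ℝ) / α) := by
  obtain ⟨ε, hε0, hε1, hεC⟩ := exists_one_add_sq_le hC₂
  obtain ⟨n₀, hn₀⟩ := exists_nat_div_le (C := lam * Real.exp lam) hε0
  have hCα : 0 ≤ C₂ / α := div_nonneg (by linarith) h0.le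
  refine ⟨∑ k ∈ Finset.Icc (-(n₀ : ℤ)) n₀, 1 / δ k.natAbs, fun m x hx => ?_⟩
  have hx1 := mem_unitDisc.1 hx
  have hterm : ∀ k ∈ Finset.Icc (-(m : ℤ)) m,
      ‖fourierWave lam m k x‖ ^ 2 / fourierNormSq lam α m k ≤
        (if k ∈ Finset.Icc (-(n₀ : ℤ)) n₀ then 1 / δ k.natAbs else 0) +
          (C₂ / α - if k = 0 then C₂ / α else 0) := by
    -- The frequency `0` is among the small ones, which leaves `2 m` terms `C₂ / α`.
    intro k hk
    have hnpos : 0 < fourierNormSq lam α m k := (hδ _).trans_le (hle m k hk)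
    have hkm : k.natAbs ≤ m := by rw [Finset.mem_Icc] at hk; omega
    by_cases hkn : k ∈ Finset.Icc (-(n₀ : ℤ)) n₀
    · rw [if_pos hkn]
      have hrest : 0 ≤ C₂ / α - if k = 0 then C₂ / α else 0 := by
        split_ifs <;> linarith
      refine le_add_of_le_of_nonneg ?_ hrest
      have := hδ k.natAbs
      refine div_le_div₀ zero_le_one ?_ this (hle m k hk)
      exact pow_le_one₀ (norm_nonneg _) (norm_fourierWave_le_one lam m k x)
    · have hk0 : k ≠ 0 := by
        rintro rfl
        apply hkn
        rw [Finset.mem_Icc]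
        omega
      rw [if_neg hkn, if_neg hk0, zero_add, sub_zero]
      have hge : n₀ ≤ k.natAbs := by
        rw [Finset.mem_Icc] at hkn
        omega
      have hεk := hn₀ _ hge
      have hA := leadTerm_pos hlam k.natAbs one_pos
      set A := leadTerm lam k.natAbs 1 with hAdef
      have hup : ‖fourierWave lam m k x‖ ≤ A * (1 + ε) := by
        have hE := (abs_le.1 (abs_norm_fourierWave_sub_leadTerm_le hlam m k hkm hx1)).2
        have hnn := leadTerm_nonneg hlam k.natAbs (norm_nonneg x)
        have hmono : leadTerm lam k.natAbs ‖x‖ ≤ A := by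
          rw [hAdef]
          unfold leadTerm
          gcongr
        calc ‖fourierWave lam m k x‖ ≤ leadTerm lam k.natAbs ‖x‖ *
              (1 + ‖x‖ * (lam * Real.exp lam) / (k.natAbs + 1)) := by linarith
          _ ≤ A * (1 + 1 * (lam * Real.exp lam) / (k.natAbs + 1)) := by gcongr
          _ ≤ A * (1 + ε) := by
            rw [one_mul]
            gcongr
      have hlow : α * (A * (1 - ε)) ^ 2 ≤ fourierNormSq lam α m k := by
        refine mul_le_integral_samplingMeasure h0.le h1 (continuous_fourierWave_normSq lam m k)
          (fun y => by positivity) fun y hy => ?_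
        have hE := (abs_le.1 (abs_norm_fourierWave_sub_leadTerm_le hlam m k hkm hy.le)).1
        rw [hy, one_mul, ← hAdef] at hE
        have : 0 ≤ A * (1 - ε) := mul_nonneg hA.le (by linarith)
        refine pow_le_pow_left₀ this ?_ 2
        nlinarith
      rw [div_le_iff₀ hnpos]
      calc ‖fourierWave lam m k x‖ ^ 2 ≤ (A * (1 + ε)) ^ 2 :=
            pow_le_pow_left₀ (norm_nonneg _) hup 2
        _ = A ^ 2 * (1 + ε) ^ 2 := by ring
        _ ≤ A ^ 2 * (C₂ * (1 - ε) ^ 2) := by gcongr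
        _ = C₂ / α * (α * (A * (1 - ε)) ^ 2) := by
          field_simp
        _ ≤ _ := by gcongr
  have h0m : (0 : ℤ) ∈ Finset.Icc (-(m : ℤ)) m := by
    rw [Finset.mem_Icc]
    omega
  refine (Finset.sum_le_sum hterm).trans ?_
  rw [Finset.sum_add_distrib, Finset.sum_sub_distrib, Finset.sum_ite_eq' _ (0 : ℤ), if_pos h0m,
    Finset.sum_const, Int.card_Icc, show ((m : ℤ) + 1 - -(m : ℤ)).toNat = 2 * m + 1 by omega,
    nsmul_eq_mul, ← Finset.sum_filter]
  have hsmall : ∑ k ∈ (Finset.Icc (-(m : ℤ)) m).filter (· ∈ Finset.Icc (-(n₀ : ℤ)) n₀),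
      1 / δ k.natAbs ≤ ∑ k ∈ Finset.Icc (-(n₀ : ℤ)) n₀, 1 / δ k.natAbs := by
    refine Finset.sum_le_sum_of_subset_of_nonneg ?_ fun k _ _ => (one_div_pos.2 (hδ _)).le
    intro k hk
    exact (Finset.mem_filter.1 hk).2
  have hmain : ((2 * m + 1 : ℕ) : ℝ) * (C₂ / α) - C₂ / α = C₂ * (2 * (m : ℝ) / α) := by
    push_cast
    ring
  rw [hmain]
  exact add_le_add_left hsmall _

end

/-- Lower bound on `K(m)` for the uniform measure, and upper bound for mixed sampling. In the
case `α = 1` (sampling on the circle only) no Bessel function of integer order may vanish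
at `lam`. -/
theorem theorem4p2 (lam : ℝ) (hlam : 0 < lam) :
    (∀ c₁ : ℝ, c₁ < 1 / 4 → ∃ c₀ : ℝ, ∃ m₀ : ℕ, ∀ m : ℕ, m₀ ≤ m →
      ∃ K : ℝ, IsKernelMax (planeWaveSpace lam m) (samplingMeasure 0) K ∧
        c₀ + c₁ * (m : ℝ) ^ 2 ≤ K) ∧
    (∀ α : ℝ, 0 < α → α ≤ 1 → (α = 1 → ∀ n : ℕ, besselJ n lam ≠ 0) →
      ∀ C₂ : ℝ, 1 < C₂ → ∃ C₁ : ℝ, ∀ m : ℕ,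
        ∃ K : ℝ, IsKernelMax (planeWaveSpace lam m) (samplingMeasure α) K ∧
          K ≤ C₁ + C₂ * (2 * (m : ℝ) / α)) := by
  constructor
  · intro c₁ hc₁
    obtain ⟨c₀, hc₀⟩ := exists_le_waveKernel_zero hlam
    obtain ⟨δ, hδ, hle⟩ := exists_le_fourierNormSq hlam le_rfl zero_le_one
      (fun h => absurd h zero_ne_one)
    refine ⟨c₀, 0, fun m _ => ?_⟩
    obtain ⟨K, hK, hgr⟩ := exists_isKernelMax le_rfl zero_le_one lam m
      (fun k hk => (hδ _).trans_le (hle m k hk))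
    refine ⟨K, hK, ?_⟩
    have h2 := hgr.2 ⟨circlePoint 0, mem_unitDisc.2 (norm_circlePoint 0).le, rfl⟩
    nlinarith [hc₀ m, sq_nonneg (m : ℝ)]
  · intro α h0 h1 hJ C₂ hC₂
    obtain ⟨δ, hδ, hle⟩ := exists_le_fourierNormSq hlam h0.le h1 hJ
    obtain ⟨C₁, hC₁⟩ := exists_waveKernel_le hlam h0 h1 hδ hle hC₂
    refine ⟨C₁, fun m => ?_⟩
    obtain ⟨K, hK, hgr⟩ := exists_isKernelMax h0.le h1 lam m
      (fun k hk => (hδ _).trans_le (hle m k hk))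
    refine ⟨K, hK, ?_⟩
    obtain ⟨x, hx, rfl⟩ := hgr.1
    exact hC₁ m x hx
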